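/- **Setting.** Let $\mathcal X,\mathcal Y,\mathcal Z,\Omega,\Theta,\Sigma$ be finite sets. Fix a hidden-Markov source and two finite-state channels, with fixed initial states $\omega_0,\theta_0,\sigma_0$: for $\mathbf x\in\mathcal X^n$, $\mathbf y\in\mathcal Y^n$, $\mathbf z\in\mathcal Z^n$, $$G(\mathbf x)=\sum_{\omega_1,\dots,\omega_n}\prod_{i=1}^n G(x_i,\omega_i|\omega_{i-1}),\quad V(\mathbf y|\mathbf x)=\sum_{\theta_1,\dots,\theta_n}\prod_{i=1}^n V(y_i,\theta_i|x_i,\theta_{i-1}),\quad W(\mathbf z|\mathbf x)=\sum_{\sigma_1,\dots,\sigma_n}\prod_{i=1}^n W(z_i,\sigma_i|x_i,\sigma_{i-1}),$$ where $G(\cdot,\cdot|\omega')$, $V(\cdot,\cdot|x,\theta')$, $W(\cdot,\cdot|x,\sigma')$ are probability distributions. Put $$P(\mathbf y)=\sum_{\mathbf x}G(\mathbf x)V(\mathbf y|\mathbf x),\qquad P(\mathbf y,\mathbf z)=\sum_{\mathbf x}G(\mathbf x)V(\mathbf y|\mathbf x)W(\mathbf z|\mathbf x),\qquad P(\mathbf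 z|\mathbf y)=P(\mathbf y,\mathbf z)/P(\mathbf y),$$ $$\pi(y,\theta,\omega|\theta',\omega')=\sum_{x}G(x,\omega|\omega')V(y,\theta|x,\theta').$$ Assume $\pi(y,\theta,\omega|\theta',\omega')>0$ for all $y,\theta,\omega,\theta',\omega'$, and let $\pi_{\min}$ be the minimum of these numbers. A codebook $\mathcal C=(\mathbf y_1,\dots,\mathbf y_M)$ is drawn with independent members of law $P(\mathbf y)$; a uniformly distributed message $m\in\{1,\dots,M\}$ is chosen and $\mathbf Z$ is received, distributed according to $P(\cdot|\mathbf y_m)$. A ranking function of a metric $d(\mathbf y,\mathbf z)$ is a map $M_d(\mathbf y,\mathbf z)$ which, for each $\mathbf z$, is a bijection from $\mathcal Y^n$ onto $\{1,\dots,|\mathcal Y|^n\}$ and satisfies $M_d(\mathbf y',\mathbf z)<M_d(\mathbf y,\mathbf z)$ whenever $d(\mathbf y',\mathbf z)<d(\mathbf y,\mathbf z)$. The decoder picks the message whose codeword has the smallest rank; its average error probability $\overline{P}_{e,d}$ is the probability, over the codebook, the message and the channel, that $M_d(\mathbf y_{m'},\mathbf Z)\le M_d(\mathbf y_m,\mathbf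 Z)$ for some $m'\ne m$. The maximum-likelihood decoder, with average error probability $\overline P_{e,o}$, is the one for $d(\mathbf y,\mathbf z)=-P(\mathbf z|\mathbf y)$. The universal decoder, with average error probability $\overline P_{e,u}$, is the one for $$u(\mathbf y,\mathbf z)=\log P(\mathbf y)+\sum_{\ell}c_\ell(\mathbf y|\mathbf z)\log c_\ell(\mathbf y|\mathbf z).$$ Here the sequence of pairs $(y_1,z_1),\dots,(y_n,z_n)$ is parsed by LZ78 incremental parsing, each phrase being the shortest string not encountered before as a phrase (the last phrase may be incomplete); $\mathbf z(\ell)$, $\ell=1,2,\dots$, are the distinct strings that occur as the $\mathbf z$-components of the phrases, and $c_\ell(\mathbf y|\mathbf z)$ is the number of phrases whose $\mathbf z$-component is $\mathbf z(\ell)$. **Theorem 1.** There is an absolute constant $A>0$ such that for all finite $\mathcal Y,\mathcal Z,\Theta,\Omega,\Sigma$ and every $p>0$ there is a sequence $\epsilon(n)$ with $$\epsilon(n)=O\!\left(\frac{\log\log n}{\log n}\right),\qquad \epsilon(n)=A\,\log|\mathcal Y\times\mathcal Z|\cdot\frac{\log\log n}{\log n}+o\!\left(\frac{\log\log n}{\log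 n}\right)\qquad(n\to\infty),$$ such that for every finite $\mathcal X$, all $G,V,W$ as above with $\pi_{\min}\ge p$, all $n\ge1$ and $M\ge 1$, and all ranking functions of the two metrics (that is, all ways of breaking ties), $$\overline P_{e,u}\le e^{n\epsilon(n)}\,\overline P_{e,o}.$$ -/

import Mathlib

namespace NoisyDecoding

/-- Finite-state (hidden Markov) source with alphabet `X` and state set `Ω`:
`prob ω' x ω` is `G(x, ω | ω')`, and `init` is the fixed initial state `ω₀`. -/
structure FSSource (X Ω : Type*) [Fintype X] [Fintype Ω] where
  prob : Ω → X → Ω → ℝ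
  init : Ω
  nonneg : ∀ ω' x ω, 0 ≤ prob ω' x ω
  sum_eq_one : ∀ ω', ∑ x, ∑ ω, prob ω' x ω = 1

/-- Finite-state (non-unifilar) channel with input alphabet `A`, output alphabet `B` and state
set `S`: `prob a s' b s` is `W(b, s | a, s')`, and `init` is the fixed initial state `s₀`. -/
structure FSChannel (A B S : Type*) [Fintype B] [Fintype S] where
  prob : A → S → B → S → ℝ
  init : S
  nonneg : ∀ a s' b s, 0 ≤ prob a s' b s
  sum_eq_one : ∀ a s', ∑ b, ∑ s, prob a s' b s = 1

/-- The state preceding time `i` along the state sequence `s`, when the initial state is `s₀`. -/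
def prevState {S : Type*} {n : ℕ} (s₀ : S) (s : Fin n → S) (i : Fin n) : S :=
  (Fin.cons s₀ s : Fin (n + 1) → S) i.castSucc

/-- `G(x) = ∑_ω ∏_i G(x_i, ω_i | ω_{i-1})`. -/
noncomputable def FSSource.law {X Ω : Type*} [Fintype X] [Fintype Ω]
    (G : FSSource X Ω) {n : ℕ} (x : Fin n → X) : ℝ :=
  ∑ ω : Fin n → Ω, ∏ i, G.prob (prevState G.init ω i) (x i) (ω i)

/-- `W(b | a) = ∑_s ∏_i W(b_i, s_i | a_i, s_{i-1})`. -/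
noncomputable def FSChannel.law {A B S : Type*} [Fintype B] [Fintype S]
    (W : FSChannel A B S) {n : ℕ} (a : Fin n → A) (b : Fin n → B) : ℝ :=
  ∑ s : Fin n → S, ∏ i, W.prob (a i) (prevState W.init s i) (b i) (s i)

section System

variable {X Y Z Ω Θ S : Type*} [Fintype X] [Fintype Y] [Fintype Z]
  [Fintype Ω] [Fintype Θ] [Fintype S]

/-- `π(y, θ, ω | θ', ω') = ∑_x G(x, ω | ω') V(y, θ | x, θ')`. -/
noncomputable def inducedKernel (G : FSSource X Ω) (V : FSChannel X Y Θ)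
    (y : Y) (θ : Θ) (ω : Ω) (θ' : Θ) (ω' : Ω) : ℝ :=
  ∑ x, G.prob ω' x ω * V.prob x θ' y θ

/-- The induced random coding distribution `P(y) = ∑_x G(x) V(y | x)`. -/
noncomputable def codeLaw (G : FSSource X Ω) (V : FSChannel X Y Θ) {n : ℕ}
    (y : Fin n → Y) : ℝ :=
  ∑ x : Fin n → X, G.law x * V.law x y

/-- `P(y, z) = ∑_x G(x) V(y | x) W(z | x)`. -/
noncomputable def jointLaw (G : FSSource X Ω) (V : FSChannel X Y Θ) (W : FSChannel X Z S)
    {n : ℕ} (y : Fin n → Y) (z : Fin n → Z) : ℝ :=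
  ∑ x : Fin n → X, G.law x * V.law x y * W.law x z

/-- The induced channel `P(z | y) = P(y, z) / P(y)`. -/
noncomputable def inducedChannel (G : FSSource X Ω) (V : FSChannel X Y Θ) (W : FSChannel X Z S)
    {n : ℕ} (z : Fin n → Z) (y : Fin n → Y) : ℝ :=
  jointLaw G V W y z / codeLaw G V y

/-- `rank` is a ranking function of the metric `d` (smaller metric values come first): for every
`z`, `y ↦ rank y z` is a bijection from `Y^n` onto `{1, …, |Y|^n}` such that `d y' z < d y z`
implies `rank y' z < rank y z`. Ties of `d` are broken arbitrarily. -/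
def IsRanking {n : ℕ} (d : (Fin n → Y) → (Fin n → Z) → ℝ)
    (rank : (Fin n → Y) → (Fin n → Z) → ℕ) : Prop :=
  ∀ z, Set.BijOn (fun y => rank y z) Set.univ (Set.Icc 1 (Fintype.card Y ^ n)) ∧
    ∀ y y', d y' z < d y z → rank y' z < rank y z

/-- Error probability, for a given noisy codebook `C`, of the decoder that picks the message whose
noisy codeword has the smallest rank; messages are equiprobable, and an error is counted as soon as
another codeword ranks no later than the transmitted one (in particular if it equals it). -/
noncomputable def codeError (G : FSSource X Ω) (V : FSChannel X Y Θ) (W : FSChannel X Z S)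
    {n : ℕ} (rank : (Fin n → Y) → (Fin n → Z) → ℕ) {M : ℕ} (C : Fin M → Fin n → Y) : ℝ :=
  (1 / (M : ℝ)) * ∑ m : Fin M, ∑ z : Fin n → Z, inducedChannel G V W z (C m) *
    (if ∃ m' : Fin M, m' ≠ m ∧ rank (C m') z ≤ rank (C m) z then 1 else 0)

/-- Average error probability over codebooks whose `M` members are drawn independently
from `codeLaw`. -/
noncomputable def avgError (G : FSSource X Ω) (V : FSChannel X Y Θ) (W : FSChannel X Z S)
    {n : ℕ} (M : ℕ) (rank : (Fin n → Y) → (Fin n → Z) → ℕ) : ℝ :=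
  ∑ C : Fin M → Fin n → Y, (∏ m, codeLaw G V (C m)) * codeError G V W rank C

end System

/-- Incremental parsing with the list `ps` of phrases found so far and the current partial
phrase `cur`: the current phrase is closed as soon as it differs from all earlier phrases.
A non-empty incomplete phrase at the end of the sequence is kept as the last phrase. -/
def lzParseAux {α : Type*} [DecidableEq α] :
    List (List α) → List α → List α → List (List α)
  | ps, cur, [] => if cur = [] then ps else ps ++ [cur]
  | ps, cur, a :: w =>
      if cur ++ [a] ∈ ps then lzParseAux ps (cur ++ [a]) w
      else lzParseAux (ps ++ [cur ++ [a]]) [] w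

/-- The LZ78 incremental parsing of a sequence: the list of its phrases. -/
def lzParse {α : Type*} [DecidableEq α] (w : List α) : List (List α) :=
  lzParseAux [] [] w

section Metric

variable {Y Z : Type*} [DecidableEq Y] [DecidableEq Z]

/-- The `z`-phrases, with multiplicity, in the joint incremental parsing of
`(y₁, z₁), …, (yₙ, zₙ)`. -/
def zPhrases {n : ℕ} (y : Fin n → Y) (z : Fin n → Z) : List (List Z) :=
  (lzParse (List.ofFn fun i => (y i, z i))).map (List.map Prod.snd)

/-- `v(y, z) = ∑_ℓ c_ℓ(y|z) log c_ℓ(y|z)`, the sum being over the distinct `z`-phrases `z(ℓ)` and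
`c_ℓ(y|z)` being the number of occurrences of `z(ℓ)` among the `z`-phrases. -/
noncomputable def lzSum {n : ℕ} (y : Fin n → Y) (z : Fin n → Z) : ℝ :=
  ∑ p ∈ (zPhrases y z).toFinset,
    ((zPhrases y z).count p : ℝ) * Real.log ((zPhrases y z).count p : ℝ)

/-- The universal decoding metric `u(y, z) = log P(y) + ∑_ℓ c_ℓ(y|z) log c_ℓ(y|z)`. -/
noncomputable def universalMetric {X Ω Θ : Type*} [Fintype X] [Fintype Y] [Fintype Ω] [Fintype Θ]
    (G : FSSource X Ω) (V : FSChannel X Y Θ) {n : ℕ} (y : Fin n → Y) (z : Fin n → Z) : ℝ :=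
  Real.log (codeLaw G V y) + lzSum y z

end Metric

end NoisyDecoding

/-! Fix the received z, write v for `lzSum` and P for the law of a codeword. Given the transmitted
y, the error probability is `collisionProb (M - 1) q`, where q is the P-mass of the sequences ranked
no later than y (`avgError_eq`). It therefore suffices to compare, for each z, the effect of these
masses under two rankings.

For the universal decoder, a sequence y' ranked no later than y satisfies P(y') e^{v(y')} ≤ P(y)
e^{v(y)}. The Kraft-type bound Σ e^{-v(y')} ≤ T β^k (`sum_exp_neg_lzSum_le`) then gives q ≤ T β^k
e^{v(y)} P(y). Here k bounds the number of phrases and T the number of possible lists of phrase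
lengths.

For an arbitrary decoder, permute the phrases of (y, z) among positions with equal z-phrases. This
keeps z and produces at least e^{v(y)} sequences up to a factor exponential in k, and positivity of
π makes each of them at least const^k as probable as y (`wordWeight_perm_le`). The joint law is
handled exactly rather than approximately: it is a sum over the states at the phrase boundaries, and
only permutations that respect the two boundary states of every phrase are used
(`exists_permuted_class`), which again costs const^k. However the class is ranked, its average
member is preceded by half of it, so the error is at least half of a collision probability at l^k
e^{v(y)} P(y) (`sum_pathWeight_le`).

Collision probability grows at most linearly, so the two bounds combine to a ratio 2 T² C^k
(`sum_collisionProb_le`). With b = |Y × Z|, k is asymptotically 2 n log b / log n and log T is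
asymptotically k log log n, so the exponent per letter is 4 log b · log log n / log n to leading
order, while C enters only at lower order. -/

namespace NoisyDecoding

/-- The properties of an incremental parsing that the analysis uses: all phrases but the last are
distinct, phrases are non-empty, and deleting the last letter of a phrase gives the empty word or
an earlier phrase. -/
structure IsIncremental {α : Type*} (L : List (List α)) : Prop where
  nodup_dropLast : L.dropLast.Nodup
  ne_nil : ∀ p ∈ L, p ≠ []
  dropLast_mem : ∀ j (hj : j < L.length), L[j].dropLast = [] ∨ L[j].dropLast ∈ L.take j

/-! ### Incremental parsing and the number of phrases. -/

section Parsing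

variable {α : Type*}

lemma dropLast_mem_concat {ps : List (List α)} {x : List α}
    (h : ∀ j (hj : j < ps.length), ps[j].dropLast = [] ∨ ps[j].dropLast ∈ ps.take j)
    (hx : x.dropLast = [] ∨ x.dropLast ∈ ps) :
    ∀ j (hj : j < (ps ++ [x]).length),
      (ps ++ [x])[j].dropLast = [] ∨ (ps ++ [x])[j].dropLast ∈ (ps ++ [x]).take j := by
  intro j hj
  rcases lt_or_ge j ps.length with hlt | hge
  · rw [List.getElem_append_left hlt, List.take_append_of_le_length hlt.le]
    exact h j hlt
  · obtain rfl : j = ps.length := by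
      simp at hj; omega
    simpa using hx

/-- The loop invariant is that the partial phrase is empty or already a phrase; hence a newly closed
phrase extends an earlier one by one letter, and only a final incomplete phrase can be a repetition.
-/
lemma lzParseAux_spec [DecidableEq α] (w : List α) : ∀ (ps : List (List α)) (cur : List α),
    ps.Nodup → (∀ p ∈ ps, p ≠ []) →
    (∀ j (hj : j < ps.length), ps[j].dropLast = [] ∨ ps[j].dropLast ∈ ps.take j) →
    (cur = [] ∨ cur ∈ ps) →
    IsIncremental (lzParseAux ps cur w) ∧ (lzParseAux ps cur w).flatten = ps.flatten ++ cur ++ w := by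
  induction w with
  | nil =>
    intro ps cur hnd hne hpre hcur
    unfold lzParseAux
    split_ifs with h
    · subst h
      exact ⟨⟨hnd.sublist (List.dropLast_sublist _), hne, hpre⟩, by simp⟩
    · have hmem := hcur.resolve_left h
      refine ⟨⟨by simpa using hnd, ?_, dropLast_mem_concat hpre ?_⟩, by simp⟩
      · intro p hp
        rcases List.mem_append.1 hp with hp | hp
        · exact hne p hp
        · rw [List.mem_singleton.1 hp]; exact h
      · obtain ⟨i, hi, rfl⟩ := List.getElem_of_mem hmem
        exact (hpre i hi).imp id (fun h => List.mem_of_mem_take h)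
  | cons a w ih =>
    intro ps cur hnd hne hpre hcur
    unfold lzParseAux
    split_ifs with h
    · have := ih ps (cur ++ [a]) hnd hne hpre (Or.inr h)
      simpa using this
    · have := ih (ps ++ [cur ++ [a]]) [] (List.nodup_append.2
        ⟨hnd, List.nodup_singleton _, by
          intro x hx y hy hxy
          rw [List.mem_singleton.1 hy] at hxy
          exact h (hxy ▸ hx)⟩) (by
          intro p hp
          rcases List.mem_append.1 hp with hp | hp
          · exact hne p hp
          · rw [List.mem_singleton.1 hp]; simp) (dropLast_mem_concat hpre (by simpa using hcur))
        (Or.inl rfl)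
      simpa using this

lemma isIncremental_lzParse [DecidableEq α] (w : List α) : IsIncremental (lzParse w) :=
  (lzParseAux_spec w [] [] (by simp) (by simp) (by simp) (Or.inl rfl)).1

lemma flatten_lzParse [DecidableEq α] (w : List α) : (lzParse w).flatten = w := by
  simpa only [lzParse, List.flatten_nil, List.nil_append] using
    (lzParseAux_spec w [] [] (by simp) (by simp) (by simp) (Or.inl rfl)).2

/-- The number of words of length below `a` over an alphabet with `b ≥ 2` letters is at most
`b ^ a`. -/
lemma card_le_pow_of_length_lt [Fintype α] (hα : 2 ≤ Fintype.card α) (a : ℕ)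
    (s : Finset (List α)) (hs : ∀ w ∈ s, w.length < a) : s.card ≤ Fintype.card α ^ a := by
  classical
  have hsub : s ⊆ (Finset.range a).biUnion fun i =>
      (Finset.univ : Finset (Fin i → α)).image List.ofFn := by
    intro w hw
    simp only [Finset.mem_biUnion, Finset.mem_range, Finset.mem_image, Finset.mem_univ, true_and]
    exact ⟨w.length, hs w hw, w.get, by simp⟩
  calc s.card ≤ _ := Finset.card_le_card hsub
    _ ≤ ∑ i ∈ Finset.range a, ((Finset.univ : Finset (Fin i → α)).image List.ofFn).card :=
        Finset.card_biUnion_le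
    _ ≤ ∑ i ∈ Finset.range a, Fintype.card α ^ i := by
        refine Finset.sum_le_sum fun i _ => Finset.card_image_le.trans ?_
        simp
    _ ≤ Fintype.card α ^ a := (Nat.geomSum_lt hα (by simp)).le

/-- Apart from the last phrase, which accounts for the 1, phrases are distinct: at most b^a are
shorter than a, and the others use up at least a letters each. -/
lemma length_le_of_isIncremental [Fintype α] (hα : 2 ≤ Fintype.card α) {L : List (List α)}
    (hL : IsIncremental L) {a : ℕ} (ha : 0 < a) :
    L.length ≤ 1 + Fintype.card α ^ a + L.flatten.length / a := by
  classical
  set D := L.dropLast.toFinset with hD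
  have hcard : L.length ≤ D.card + 1 := by
    rw [hD, List.toFinset_card_of_nodup hL.nodup_dropLast, List.length_dropLast]; omega
  have hsplit := Finset.card_filter_add_card_filter_not (s := D) (fun w : List α => w.length < a)
  have hshort : (D.filter fun w : List α => w.length < a).card ≤ Fintype.card α ^ a :=
    card_le_pow_of_length_lt hα a _ (by simp)
  have hlong : (D.filter fun w : List α => ¬ w.length < a).card ≤ L.flatten.length / a := by
    rw [Nat.le_div_iff_mul_le ha, ← smul_eq_mul]
    calc _ ≤ ∑ w ∈ D.filter fun w : List α => ¬ w.length < a, w.length :=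
          Finset.card_nsmul_le_sum _ _ _ (by simp)
      _ ≤ ∑ w ∈ D, w.length := Finset.sum_le_sum_of_subset (Finset.filter_subset _ _)
      _ = (L.dropLast.map List.length).sum := by
          rw [hD, List.sum_toFinset _ hL.nodup_dropLast]
      _ ≤ (L.map List.length).sum :=
          (List.Sublist.map _ (List.dropLast_sublist L)).sum_le_sum (by simp)
      _ = L.flatten.length := by rw [List.length_flatten]
  omega

end Parsing

/-! ### Counting the possible lists of phrase lengths. -/

section LengthLists

/-- Lists of at most `k` positive integers with sum `n`. -/
def boundedCompositions (n k : ℕ) : Set (List ℕ) :=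
  {τ | τ.sum = n ∧ τ.length ≤ k ∧ ∀ a ∈ τ, 0 < a}

/-- Generating-function bound at x = 1 - d: each list has weight x^n, and all weights together are
at most (1 + x + x² + ⋯)^k = d^{-k}. -/
lemma card_le_of_subset_boundedCompositions {n k : ℕ} (s : Finset (List ℕ))
    (hs : ↑s ⊆ boundedCompositions n k) {d : ℝ} (hd0 : 0 < d) (hd1 : d < 1) :
    (s.card : ℝ) ≤ ((1 - d) ^ n)⁻¹ * (d ^ k)⁻¹ := by
  classical
  have hx : 0 < 1 - d := by linarith
  -- Padding with zeros up to length k loses nothing, because the entries of the lists are positive.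
  let pad : List ℕ → Fin k → ℕ := fun τ j => τ.getD j 0
  have hsum : ∀ τ ∈ s, ∑ j, pad τ j = n := by
    intro τ hτ
    obtain ⟨h1, h2, -⟩ := hs hτ
    rw [← h1, Fin.sum_univ_eq_sum_range (fun j => τ.getD j 0) k,
      ← Finset.sum_subset (Finset.range_mono h2)]
    · conv_rhs => rw [← List.ofFn_getElem (xs := τ), List.sum_ofFn]
      rw [Finset.sum_range]
      exact Finset.sum_congr rfl fun j _ => by simp
    · intro j _ hj
      simp at hj
      simp [hj]
  have hinj : Set.InjOn pad s := by
    intro τ hτ τ' hτ' h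
    obtain ⟨-, h2, h3⟩ := hs hτ
    obtain ⟨-, h2', h3'⟩ := hs hτ'
    have key : ∀ j, τ.getD j 0 = τ'.getD j 0 := by
      intro j
      rcases lt_or_ge j k with hj | hj
      · exact congrFun h ⟨j, hj⟩
      · simp [List.getElem?_eq_none (h2.trans hj), List.getElem?_eq_none (h2'.trans hj)]
    apply List.ext_getElem?
    intro j
    have := key j
    rcases lt_or_ge j τ.length with hj | hj <;> rcases lt_or_ge j τ'.length with hj' | hj' <;>
      simp [hj, hj'] at this ⊢
    · exact this
    · exact absurd this (h3 _ (List.getElem_mem _)).ne'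
    · exact absurd this.symm (h3' _ (List.getElem_mem _)).ne'
  have hmem : ∀ τ ∈ s, pad τ ∈ Fintype.piFinset fun _ : Fin k => Finset.range (n + 1) := by
    intro τ hτ
    rw [Fintype.mem_piFinset]
    intro j
    rw [Finset.mem_range, Nat.lt_succ_iff, ← hsum τ hτ]
    exact Finset.single_le_sum (fun _ _ => Nat.zero_le _) (Finset.mem_univ j)
  have hgeom : ∑ i ∈ Finset.range (n + 1), (1 - d) ^ i ≤ d⁻¹ := by
    have := geom_sum_mul_neg (1 - d) (n + 1)
    rw [sub_sub_cancel] at this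
    rw [← one_div, le_div_iff₀ hd0, this]
    linarith [pow_pos hx (n + 1)]
  have hmain : (s.card : ℝ) * (1 - d) ^ n ≤ (d ^ k)⁻¹ := by
    calc (s.card : ℝ) * (1 - d) ^ n = ∑ τ ∈ s, ∏ j, (1 - d) ^ pad τ j := by
          rw [← nsmul_eq_mul, ← Finset.sum_const]
          exact Finset.sum_congr rfl fun τ hτ => by rw [Finset.prod_pow_eq_pow_sum, hsum τ hτ]
      _ = ∑ f ∈ s.image pad, ∏ j, (1 - d) ^ f j := by rw [Finset.sum_image hinj]
      _ ≤ ∑ f ∈ Fintype.piFinset fun _ : Fin k => Finset.range (n + 1), ∏ j, (1 - d) ^ f j :=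
          Finset.sum_le_sum_of_subset_of_nonneg
            (fun f hf => by
              obtain ⟨τ, hτ, rfl⟩ := Finset.mem_image.1 hf
              exact hmem τ hτ)
            fun f _ _ => Finset.prod_nonneg fun j _ => (pow_pos hx _).le
      _ = (∑ i ∈ Finset.range (n + 1), (1 - d) ^ i) ^ k := by
          rw [← Finset.prod_univ_sum (fun _ : Fin k => Finset.range (n + 1))
            (fun _ i => (1 - d) ^ i)]
          simp
      _ ≤ d⁻¹ ^ k := by gcongr
      _ = (d ^ k)⁻¹ := inv_pow _ _
  rw [← div_eq_inv_mul, le_div_iff₀ (pow_pos hx n)]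
  exact hmain

end LengthLists

/-! ### Weights of words as matrix products, and their stability under permutation of blocks. -/

section PathSums

variable {σ : Type*}

lemma prevState_cons_succ {n : ℕ} (s₀ u : σ) (s : Fin n → σ) (i : Fin n) :
    prevState s₀ (Fin.cons u s : Fin (n + 1) → σ) i.succ = prevState u s i := by
  simp only [prevState, ← Fin.succ_castSucc, Fin.cons_succ]

lemma prevState_zero {n : ℕ} (s₀ : σ) (s : Fin (n + 1) → σ) : prevState s₀ s 0 = s₀ := rfl

lemma prevState_map {ρ : Type*} {n : ℕ} (g : σ → ρ) (s₀ : σ) (s : Fin n → σ) (i : Fin n) :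
    g (prevState s₀ s i) = prevState (g s₀) (fun j => g (s j)) i := by
  cases n with
  | zero => exact i.elim0
  | succ n =>
    induction i using Fin.cases with
    | zero => rfl
    | succ i => simp only [prevState, ← Fin.succ_castSucc, Fin.cons_succ]

lemma sum_fin_succ_arrow {α : Type*} [Fintype α] {n : ℕ} (f : (Fin (n + 1) → α) → ℝ) :
    ∑ a, f a = ∑ u, ∑ b : Fin n → α, f (Fin.cons u b) := by
  rw [← (Fin.consEquiv fun _ : Fin (n + 1) => α).sum_comp, Fintype.sum_prod_type]
  rfl

variable [Fintype σ]

/-- A product of matrices, summed over the last index, is a sum over paths. -/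
lemma sum_prod_ofFn_apply [DecidableEq σ] {n : ℕ} (K : Fin n → Matrix σ σ ℝ) (s₀ : σ) :
    ∑ t, (List.ofFn K).prod s₀ t = ∑ s : Fin n → σ, ∏ i, K i (prevState s₀ s i) (s i) := by
  induction n generalizing s₀ with
  | zero => simp [Matrix.one_apply]
  | succ n ih =>
    rw [sum_fin_succ_arrow]
    simp only [List.ofFn_succ, List.prod_cons, Matrix.mul_apply,
      Fin.prod_univ_succ, prevState_cons_succ, prevState_zero, Fin.cons_zero, Fin.cons_succ]
    rw [Finset.sum_comm]
    refine Finset.sum_congr rfl fun u _ => ?_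
    rw [← Finset.mul_sum, ih, Finset.mul_sum]

variable {α : Type*}

/-- The transition matrix of a word. -/
noncomputable def wordMatrix [DecidableEq σ] (K : α → Matrix σ σ ℝ) (w : List α) : Matrix σ σ ℝ :=
  (w.map K).prod

/-- The total weight of all state paths along a word that start in `s₀`. -/
noncomputable def wordWeight [DecidableEq σ] (K : α → Matrix σ σ ℝ) (s₀ : σ) (w : List α) : ℝ :=
  ∑ t, wordMatrix K w s₀ t

lemma wordMatrix_nonneg [DecidableEq σ] {K : α → Matrix σ σ ℝ} (hK : ∀ a s t, 0 ≤ K a s t)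
    (w : List α) (s t : σ) : 0 ≤ wordMatrix K w s t := by
  induction w generalizing s with
  | nil => simp only [wordMatrix, List.map_nil, List.prod_nil, Matrix.one_apply]; split_ifs <;> simp
  | cons a w ih =>
    simp only [wordMatrix, List.map_cons, List.prod_cons, Matrix.mul_apply]
    exact Finset.sum_nonneg fun u _ => mul_nonneg (hK a s u) (ih u)

/-- Only the states at block boundaries remain; the blocks may come from any cutting of the word,
not just from its own parsing. -/
lemma wordWeight_flatten [DecidableEq σ] (K : α → Matrix σ σ ℝ) (s₀ : σ) {c : ℕ}
    (w : Fin c → List α) :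
    wordWeight K s₀ (List.ofFn w).flatten =
      ∑ s : Fin c → σ, ∏ j, wordMatrix K (w j) (prevState s₀ s j) (s j) := by
  rw [← sum_prod_ofFn_apply (fun j => wordMatrix K (w j))]
  simp only [wordWeight, wordMatrix, List.map_flatten, List.prod_flatten, List.map_ofFn,
    Function.comp_def]

lemma wordWeight_ofFn [DecidableEq σ] (K : α → Matrix σ σ ℝ) (s₀ : σ) {n : ℕ} (a : Fin n → α) :
    wordWeight K s₀ (List.ofFn a) = ∑ s : Fin n → σ, ∏ i, K (a i) (prevState s₀ s i) (s i) := by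
  rw [← sum_prod_ofFn_apply (fun i => K (a i))]
  simp only [wordWeight, wordMatrix, List.map_ofFn, Function.comp_def]

lemma kernel_le_one [DecidableEq σ] [Fintype α] {K : α → Matrix σ σ ℝ}
    (hK : ∀ a s t, 0 ≤ K a s t) (hsum : ∀ s, ∑ a, ∑ t, K a s t = 1) (a : α) (s t : σ) :
    K a s t ≤ 1 := by
  rw [← hsum s]
  exact (Finset.single_le_sum (fun t _ => hK a s t) (Finset.mem_univ t)).trans
    (Finset.single_le_sum (f := fun a => ∑ t, K a s t)
      (fun a _ => Finset.sum_nonneg fun t _ => hK a s t) (Finset.mem_univ a))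

/-- With entries in `[p, 1]`, the rows of the matrix of a non-empty word are comparable. -/
lemma wordMatrix_row_le [DecidableEq σ] {K : α → Matrix σ σ ℝ} {p : ℝ}
    (hp : 0 < p) (hK : ∀ a s t, p ≤ K a s t) (hK1 : ∀ a s t, K a s t ≤ 1) {w : List α}
    (hw : w ≠ []) (s s' t : σ) : p * wordMatrix K w s t ≤ wordMatrix K w s' t := by
  obtain ⟨a, w, rfl⟩ := List.exists_cons_of_ne_nil hw
  simp only [wordMatrix, List.map_cons, List.prod_cons, Matrix.mul_apply]
  rw [Finset.mul_sum]
  refine Finset.sum_le_sum fun u _ => ?_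
  have h0 := wordMatrix_nonneg (fun a s t => hp.le.trans (hK a s t)) w u t
  rw [← mul_assoc]
  refine mul_le_mul_of_nonneg_right ?_ h0
  nlinarith [hK a s' u, hK1 a s u]

lemma wordMatrix_col_le [DecidableEq σ] {K : α → Matrix σ σ ℝ} {p : ℝ}
    (hp : 0 < p) (hK : ∀ a s t, p ≤ K a s t) (hK1 : ∀ a s t, K a s t ≤ 1) {w : List α}
    (hw : w ≠ []) (s t t' : σ) : p * wordMatrix K w s t ≤ wordMatrix K w s t' := by
  obtain ⟨w, a, rfl⟩ := (List.eq_nil_or_concat w).resolve_left hw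
  simp only [wordMatrix, List.concat_eq_append, List.map_append, List.map_cons, List.map_nil,
    List.prod_append, List.prod_singleton, Matrix.mul_apply]
  rw [Finset.mul_sum]
  refine Finset.sum_le_sum fun u _ => ?_
  have h0 := wordMatrix_nonneg (fun a s t => hp.le.trans (hK a s t)) w s u
  simp only [wordMatrix] at h0
  have : p * K a u t ≤ K a u t' := by nlinarith [hK a u t', hK1 a u t]
  nlinarith

/-- Only the first and the last letter see the end states, and each costs a factor p. -/
lemma wordMatrix_comparable [DecidableEq σ] {K : α → Matrix σ σ ℝ} {p : ℝ}
    (hp : 0 < p) (hK : ∀ a s t, p ≤ K a s t) (hK1 : ∀ a s t, K a s t ≤ 1) {w : List α}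
    (hw : w ≠ []) (s t s' t' : σ) : p ^ 2 * wordMatrix K w s t ≤ wordMatrix K w s' t' := by
  have h1 := wordMatrix_row_le hp hK hK1 hw s s' t
  have h2 := wordMatrix_col_le hp hK hK1 hw s' t t'
  nlinarith

/-- Permuting the phrases changes the weight by at most an exponential factor in their number. -/
lemma wordWeight_perm_le [DecidableEq σ] {K : α → Matrix σ σ ℝ} {p : ℝ}
    (hp : 0 < p) (hK : ∀ a s t, p ≤ K a s t) (hK1 : ∀ a s t, K a s t ≤ 1) (s₀ : σ) {c : ℕ}
    {w : Fin c → List α} (hw : ∀ j, w j ≠ []) (h : Equiv.Perm (Fin c)) :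
    (p ^ 4 / Fintype.card σ) ^ c * wordWeight K s₀ (List.ofFn w).flatten ≤
      wordWeight K s₀ (List.ofFn (w ∘ h)).flatten := by
  have hK0 := fun a s t => hp.le.trans (hK a s t)
  have hcard : (0 : ℝ) < Fintype.card σ := by exact_mod_cast Fintype.card_pos_iff.2 ⟨s₀⟩
  -- This reference product does not depend on the order of the blocks. From above, each of the
  -- |σ|^c boundary paths is at most p^{-2c} g; from below, the constant path at `s₀` alone gives
  -- p^{2c} g.
  set g : ℝ := ∏ j, wordMatrix K (w j) s₀ s₀ with hg
  have hg0 : 0 ≤ g := Finset.prod_nonneg fun j _ => wordMatrix_nonneg hK0 _ _ _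
  have hup : (p ^ 2) ^ c * wordWeight K s₀ (List.ofFn w).flatten ≤
      (Fintype.card σ : ℝ) ^ c * g := by
    rw [wordWeight_flatten, Finset.mul_sum]
    calc _ ≤ ∑ _s : Fin c → σ, g := by
          refine Finset.sum_le_sum fun s _ => ?_
          rw [hg, show (p ^ 2) ^ c = ∏ _j : Fin c, p ^ 2 by simp, ← Finset.prod_mul_distrib]
          exact Finset.prod_le_prod
            (fun j _ => mul_nonneg (by positivity) (wordMatrix_nonneg hK0 _ _ _))
            fun j _ => wordMatrix_comparable hp hK hK1 (hw j) _ _ _ _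
      _ = _ := by simp
  have hlow : (p ^ 2) ^ c * g ≤ wordWeight K s₀ (List.ofFn (w ∘ h)).flatten := by
    rw [wordWeight_flatten]
    refine le_trans ?_ (Finset.single_le_sum (f := fun s : Fin c → σ =>
      ∏ j, wordMatrix K ((w ∘ h) j) (prevState s₀ s j) (s j))
      (fun s _ => Finset.prod_nonneg fun j _ => wordMatrix_nonneg hK0 _ _ _)
      (Finset.mem_univ fun _ => s₀))
    rw [hg, ← Equiv.prod_comp h, show (p ^ 2) ^ c = ∏ _j : Fin c, p ^ 2 by simp,
      ← Finset.prod_mul_distrib]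
    exact Finset.prod_le_prod
      (fun j _ => mul_nonneg (by positivity) (wordMatrix_nonneg hK0 _ _ _))
      fun j _ => wordMatrix_comparable hp hK hK1 (hw (h j)) _ _ _ _
  rw [div_pow, div_mul_eq_mul_div, div_le_iff₀ (by positivity)]
  calc (p ^ 4) ^ c * wordWeight K s₀ (List.ofFn w).flatten
      = (p ^ 2) ^ c * ((p ^ 2) ^ c * wordWeight K s₀ (List.ofFn w).flatten) := by
        rw [← mul_assoc, ← mul_pow]; ring
    _ ≤ (p ^ 2) ^ c * ((Fintype.card σ : ℝ) ^ c * g) := by gcongr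
    _ = ((p ^ 2) ^ c * g) * (Fintype.card σ : ℝ) ^ c := by ring
    _ ≤ _ := by gcongr

lemma sum_wordWeight_ofFn [DecidableEq σ] [Fintype α] {K : α → Matrix σ σ ℝ}
    (hsum : ∀ s, ∑ a, ∑ t, K a s t = 1) (s₀ : σ) (n : ℕ) :
    ∑ a : Fin n → α, wordWeight K s₀ (List.ofFn a) = 1 := by
  induction n generalizing s₀ with
  | zero => simp [wordWeight, wordMatrix, Matrix.one_apply]
  | succ n ih =>
    rw [sum_fin_succ_arrow, ← hsum s₀]
    refine Finset.sum_congr rfl fun a _ => ?_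
    have : ∀ b : Fin n → α, wordWeight K s₀ (List.ofFn (Fin.cons a b : Fin (n + 1) → α)) =
        ∑ u, K a s₀ u * wordWeight K u (List.ofFn b) := by
      intro b
      simp only [wordWeight, wordMatrix, List.ofFn_succ, Fin.cons_zero, Fin.cons_succ,
        List.map_cons, List.prod_cons, Matrix.mul_apply]
      rw [Finset.sum_comm]
      simp only [Finset.mul_sum]
    simp only [this]
    rw [Finset.sum_comm]
    exact Finset.sum_congr rfl fun u _ => by rw [← Finset.mul_sum, ih, mul_one]

end PathSums

/-! ### The induced laws as word weights. -/

section Laws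

variable {X Y Z Ω Θ S : Type*} [Fintype X] [Fintype Y] [Fintype Z]
  [Fintype Ω] [Fintype Θ] [Fintype S]

/-- The kernel `π` as a family of matrices on the state set `Θ × Ω`. -/
noncomputable def codeKernel (G : FSSource X Ω) (V : FSChannel X Y Θ) (y : Y) :
    Matrix (Θ × Ω) (Θ × Ω) ℝ :=
  fun a b => inducedKernel G V y b.1 b.2 a.1 a.2

/-- The kernel of the pair of outputs, on the state set `Ω × Θ × S`. -/
noncomputable def jointKernel (G : FSSource X Ω) (V : FSChannel X Y Θ) (W : FSChannel X Z S)
    (q : Y × Z) : Matrix (Ω × Θ × S) (Ω × Θ × S) ℝ :=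
  fun a b => ∑ x, G.prob a.1 x b.1 * V.prob x a.2.1 q.1 b.2.1 * W.prob x a.2.2 q.2 b.2.2

lemma sum_arrow_prod {A B : Type*} [Fintype A] [Fintype B] {n : ℕ}
    (f : (Fin n → A) → (Fin n → B) → ℝ) :
    ∑ a, ∑ b, f a b = ∑ s : Fin n → A × B, f (fun i => (s i).1) (fun i => (s i).2) := by
  rw [← Fintype.sum_prod_type' f,
    ← (Equiv.arrowProdEquivProdArrow (Fin n) (fun _ => A) (fun _ => B)).sum_comp]
  rfl

/-- Once the state paths are fixed, the sum over the channel inputs factorises over time into the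
entries of the kernel. -/
lemma codeLaw_eq_wordWeight [DecidableEq (Θ × Ω)] (G : FSSource X Ω) (V : FSChannel X Y Θ) {n : ℕ}
    (y : Fin n → Y) :
    codeLaw G V y = wordWeight (codeKernel G V) (V.init, G.init) (List.ofFn y) := by
  classical
  rw [wordWeight_ofFn]
  have h1 : ∀ x : Fin n → X, G.law x * V.law x y = ∑ s : Fin n → Θ × Ω,
      ∏ i, (G.prob (prevState G.init (fun i => (s i).2) i) (x i) (s i).2 *
        V.prob (x i) (prevState V.init (fun i => (s i).1) i) (y i) (s i).1) := by
    intro x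
    rw [← sum_arrow_prod fun (θ : Fin n → Θ) (ω : Fin n → Ω) =>
      ∏ i, (G.prob (prevState G.init ω i) (x i) (ω i) *
        V.prob (x i) (prevState V.init θ i) (y i) (θ i)),
      FSSource.law, FSChannel.law, Finset.sum_mul_sum, Finset.sum_comm]
    simp only [Finset.prod_mul_distrib]
  simp only [codeLaw, h1]
  rw [Finset.sum_comm]
  refine Finset.sum_congr rfl fun s _ => ?_
  simp only [codeKernel, inducedKernel, prevState_map Prod.fst, prevState_map Prod.snd]
  rw [Finset.prod_univ_sum]
  simp

lemma jointLaw_eq_wordWeight [DecidableEq (Ω × Θ × S)] (G : FSSource X Ω) (V : FSChannel X Y Θ)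
    (W : FSChannel X Z S) {n : ℕ} (y : Fin n → Y) (z : Fin n → Z) :
    jointLaw G V W y z = wordWeight (jointKernel G V W) (G.init, V.init, W.init)
      (List.ofFn fun i => (y i, z i)) := by
  classical
  rw [wordWeight_ofFn]
  have h1 : ∀ x : Fin n → X, G.law x * V.law x y * W.law x z = ∑ s : Fin n → Ω × Θ × S,
      ∏ i, (G.prob (prevState G.init (fun i => (s i).1) i) (x i) (s i).1 *
        V.prob (x i) (prevState V.init (fun i => (s i).2.1) i) (y i) (s i).2.1 *
        W.prob (x i) (prevState W.init (fun i => (s i).2.2) i) (z i) (s i).2.2) := by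
    intro x
    rw [← sum_arrow_prod fun (ω : Fin n → Ω) (r : Fin n → Θ × S) =>
      ∏ i, (G.prob (prevState G.init ω i) (x i) (ω i) *
        V.prob (x i) (prevState V.init (fun i => (r i).1) i) (y i) (r i).1 *
        W.prob (x i) (prevState W.init (fun i => (r i).2) i) (z i) (r i).2)]
    rw [FSSource.law, FSChannel.law, FSChannel.law, mul_assoc, Finset.sum_mul]
    refine Finset.sum_congr rfl fun ω _ => ?_
    rw [Finset.sum_mul_sum, Finset.mul_sum, ← sum_arrow_prod fun (θ : Fin n → Θ) (s : Fin n → S) =>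
      ∏ i, (G.prob (prevState G.init ω i) (x i) (ω i) *
        V.prob (x i) (prevState V.init θ i) (y i) (θ i) *
        W.prob (x i) (prevState W.init s i) (z i) (s i))]
    simp only [Finset.mul_sum, Finset.prod_mul_distrib, mul_assoc]
  simp only [jointLaw, h1]
  rw [Finset.sum_comm]
  refine Finset.sum_congr rfl fun s _ => ?_
  simp only [jointKernel, prevState_map Prod.fst, prevState_map Prod.snd]
  rw [Finset.prod_univ_sum]
  simp

lemma sum_codeKernel (G : FSSource X Ω) (V : FSChannel X Y Θ) (a : Θ × Ω) :
    ∑ y, ∑ b, codeKernel G V y a b = 1 := by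
  simp only [codeKernel, inducedKernel, Fintype.sum_prod_type]
  have : ∀ x ω, ∑ y, ∑ θ, G.prob a.2 x ω * V.prob x a.1 y θ = G.prob a.2 x ω := by
    intro x ω
    simp only [← Finset.mul_sum, V.sum_eq_one, mul_one]
  calc _ = ∑ x, ∑ ω, ∑ y, ∑ θ, G.prob a.2 x ω * V.prob x a.1 y θ := by
        simp_rw [Finset.sum_comm (s := (Finset.univ : Finset Ω)) (t := (Finset.univ : Finset X))]
        simp_rw [Finset.sum_comm (s := (Finset.univ : Finset Θ)) (t := (Finset.univ : Finset X))]
        simp_rw [Finset.sum_comm (s := (Finset.univ : Finset Y)) (t := (Finset.univ : Finset X))]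
        refine Finset.sum_congr rfl fun x _ => ?_
        simp_rw [Finset.sum_comm (s := (Finset.univ : Finset Θ)) (t := (Finset.univ : Finset Ω))]
        rw [Finset.sum_comm]
    _ = 1 := by simp only [this, G.sum_eq_one]

lemma jointKernel_nonneg (G : FSSource X Ω) (V : FSChannel X Y Θ) (W : FSChannel X Z S)
    (q : Y × Z) (a b : Ω × Θ × S) : 0 ≤ jointKernel G V W q a b :=
  Finset.sum_nonneg fun _ _ =>
    mul_nonneg (mul_nonneg (G.nonneg _ _ _) (V.nonneg _ _ _ _)) (W.nonneg _ _ _ _)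

end Laws

/-! ### Collision probabilities and rankings of a class. -/

section Collision

/-- The probability that at least one of `m` independent trials of success probability `t`
succeeds. -/
noncomputable def collisionProb (m : ℕ) (t : ℝ) : ℝ := 1 - (1 - t) ^ m

lemma collisionProb_mono (m : ℕ) {s t : ℝ} (hst : s ≤ t) (ht : t ≤ 1) :
    collisionProb m s ≤ collisionProb m t := by
  unfold collisionProb
  gcongr

lemma collisionProb_nonneg (m : ℕ) {t : ℝ} (ht0 : 0 ≤ t) (ht : t ≤ 1) : 0 ≤ collisionProb m t := by
  simpa [collisionProb] using collisionProb_mono m ht0 ht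

lemma collisionProb_eq (m : ℕ) (t : ℝ) :
    collisionProb m t = t * ∑ i ∈ Finset.range m, (1 - t) ^ i := by
  have := mul_neg_geom_sum (1 - t) m
  rw [sub_sub_cancel] at this
  rw [this, collisionProb]

/-- Concavity in the form used below: `collisionProb m t / t` is a geometric sum in 1 - t, hence
decreasing in t. -/
lemma mul_collisionProb_le (m : ℕ) {a b : ℝ} (ha : 0 ≤ a) (hab : a ≤ b) (hb : b ≤ 1) :
    a * collisionProb m b ≤ b * collisionProb m a := by
  rw [collisionProb_eq, collisionProb_eq]
  have : ∑ i ∈ Finset.range m, (1 - b) ^ i ≤ ∑ i ∈ Finset.range m, (1 - a) ^ i := by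
    refine Finset.sum_le_sum fun i _ => ?_
    gcongr
  calc _ = (a * b) * ∑ i ∈ Finset.range m, (1 - b) ^ i := by ring
    _ ≤ (a * b) * ∑ i ∈ Finset.range m, (1 - a) ^ i := by
        have := ha.trans hab; gcongr
    _ = _ := by ring

lemma collisionProb_le_mul (m : ℕ) {a q l : ℝ} (ha : 0 < a) (ha1 : a ≤ 1)
    (hq1 : q ≤ 1) (hl : 1 ≤ l) (hq : q ≤ l * a) :
    collisionProb m q ≤ l * collisionProb m a := by
  have h0 := collisionProb_nonneg m ha.le ha1
  rcases le_total q a with h | h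
  · exact (collisionProb_mono m h ha1).trans (le_mul_of_one_le_left h0 hl)
  · have := mul_collisionProb_le m ha.le h hq1
    refine le_of_mul_le_mul_left (this.trans ?_) ha
    calc q * collisionProb m a ≤ (l * a) * collisionProb m a := by gcongr
      _ = _ := by ring

/-- However the elements of `D` are ranked, an average element is preceded by half of them. -/
lemma half_collisionProb_le_sum {ι : Type*} [Fintype ι] (m : ℕ) (P : ι → ℝ) (hP : ∀ i, 0 ≤ P i)
    (hP1 : ∑ i, P i = 1) (rank : ι → ℕ) (D : Finset ι) (b : ℝ) (hb : 0 ≤ b)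
    (hD : ∀ i ∈ D, b ≤ P i) :
    (D.card : ℝ) / 2 * collisionProb m (D.card * b) ≤
      ∑ i ∈ D, collisionProb m (∑ j, P j * if rank j ≤ rank i then 1 else 0) := by
  classical
  rcases D.eq_empty_or_nonempty with rfl | hne
  · simp
  have hcard : (0 : ℝ) < D.card := by exact_mod_cast hne.card_pos
  have hsub : ∀ E : Finset ι, E ⊆ D → E.card * b ≤ ∑ j ∈ E, P j := fun E hE => by
    rw [← nsmul_eq_mul]
    exact Finset.card_nsmul_le_sum _ _ _ fun j hj => hD j (hE hj)
  have hone : (D.card : ℝ) * b ≤ 1 := (hsub D subset_rfl).trans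
    (hP1 ▸ Finset.sum_le_univ_sum_of_nonneg hP)
  -- The rank of i inside `D`. By concavity the collision probability at r(i) b is at least the
  -- fraction r(i)/|D| of the one at |D| b.
  set r : ι → ℕ := fun i => (D.filter fun j => rank j ≤ rank i).card with hr
  have hpt : ∀ i ∈ D, (r i : ℝ) / D.card * collisionProb m (D.card * b) ≤
      collisionProb m (∑ j, P j * if rank j ≤ rank i then 1 else 0) := by
    intro i _
    have hri : (r i : ℝ) ≤ D.card := by exact_mod_cast Finset.card_filter_le _ _
    have h1 : (r i : ℝ) * b ≤ ∑ j, P j * if rank j ≤ rank i then 1 else 0 := by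
      refine (hsub _ (Finset.filter_subset _ _)).trans ?_
      simp only [mul_ite, mul_one, mul_zero, ← Finset.sum_filter]
      exact Finset.sum_le_sum_of_subset_of_nonneg
        (Finset.filter_subset_filter _ (Finset.subset_univ _)) fun j _ _ => hP j
    have h2 : ∑ j, P j * (if rank j ≤ rank i then 1 else 0) ≤ 1 := by
      refine (Finset.sum_le_sum fun j _ => ?_).trans_eq hP1
      split_ifs
      · simp
      · simpa using hP j
    refine le_trans ?_ (collisionProb_mono m h1 h2)
    rcases hb.eq_or_lt with rfl | hb
    · simp [collisionProb]
    have h3 := mul_collisionProb_le m (a := r i * b) (b := D.card * b) (by positivity)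
      (by gcongr) hone
    rw [div_mul_eq_mul_div, div_le_iff₀ hcard]
    refine le_of_mul_le_mul_left ?_ hb
    linarith
  -- Every ordered pair of elements is counted in at least one of its two orders.
  have hpairs : (D.card : ℝ) * D.card ≤ 2 * ∑ i ∈ D, (r i : ℝ) := by
    have h1 : ∀ i ∈ D, ∀ j ∈ D, (1 : ℝ) ≤
        (if rank j ≤ rank i then 1 else 0) + (if rank i ≤ rank j then 1 else 0) := by
      intro i _ j _
      rcases le_total (rank i) (rank j) with h | h <;> simp [h] <;> split_ifs <;> norm_num
    have h2 : ∀ i, (r i : ℝ) = ∑ j ∈ D, if rank j ≤ rank i then 1 else 0 := by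
      intro i; simp [hr]
    calc (D.card : ℝ) * D.card = ∑ i ∈ D, ∑ j ∈ D, (1 : ℝ) := by simp
      _ ≤ ∑ i ∈ D, ∑ j ∈ D, (((if rank j ≤ rank i then 1 else 0) : ℝ) +
            (if rank i ≤ rank j then 1 else 0)) :=
          Finset.sum_le_sum fun i hi => Finset.sum_le_sum fun j hj => h1 i hi j hj
      _ = 2 * ∑ i ∈ D, (r i : ℝ) := by
          simp only [Finset.sum_add_distrib, h2]
          rw [Finset.sum_comm (f := fun i j => (if rank i ≤ rank j then (1 : ℝ) else 0))]
          ring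
  refine le_trans ?_ (Finset.sum_le_sum hpt)
  rw [← Finset.sum_mul, ← Finset.sum_div]
  refine mul_le_mul_of_nonneg_right ?_ (collisionProb_nonneg m (by positivity) hone)
  rw [div_le_div_iff₀ (by norm_num) hcard]
  linarith

end Collision

/-! ### The average error as a sum of collision probabilities. -/

section ErrorFormula

/-- Expectation of a function of the `m`-th component and of the event that some other component
lies in a set that depends on the `m`-th one. -/
lemma sum_prod_mul_exists {ι : Type*} [Fintype ι] {M : ℕ} (P : ι → ℝ) (hP1 : ∑ i, P i = 1)
    (m : Fin M) (g : ι → ℝ) (R : ι → ι → Prop) [∀ a b, Decidable (R a b)]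
    [∀ C : Fin M → ι, Decidable (∃ m', m' ≠ m ∧ R (C m') (C m))] :
    ∑ C : Fin M → ι, (∏ i, P (C i)) *
        (g (C m) * if ∃ m', m' ≠ m ∧ R (C m') (C m) then 1 else 0) =
      ∑ y, P y * g y * collisionProb (M - 1) (∑ y', P y' * if R y' y then 1 else 0) := by
  classical
  -- With the m-th codeword frozen at y, independence factorises the other M - 1.
  have hkey : ∀ (y : ι) (F : ι → ℝ),
      ∑ C : Fin M → ι, (if C m = y then ∏ i, P (C i) else 0) *
        ∏ m' ∈ Finset.univ.erase m, F (C m') = P y * (∑ a, P a * F a) ^ (M - 1) := by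
    intro y F
    have h1 : ∀ C : Fin M → ι, (if C m = y then ∏ i, P (C i) else 0) *
        ∏ m' ∈ Finset.univ.erase m, F (C m') =
        ∏ i, (if i = m then (if C i = y then P (C i) else 0) else P (C i) * F (C i)) := by
      intro C
      rw [← Finset.mul_prod_erase Finset.univ (fun i => P (C i)) (Finset.mem_univ m),
        ← Finset.mul_prod_erase Finset.univ (fun i => if i = m then (if C i = y then P (C i) else 0)
          else P (C i) * F (C i)) (Finset.mem_univ m),
        Finset.prod_congr (g := fun i => P (C i) * F (C i)) rfl
          (fun i hi => if_neg (Finset.ne_of_mem_erase hi)), Finset.prod_mul_distrib]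
      simp only [if_true]
      split_ifs <;> ring
    simp only [h1]
    rw [← Fintype.piFinset_univ, ← Finset.prod_univ_sum (fun _ : Fin M => (Finset.univ : Finset ι))
      (fun i a => if i = m then (if a = y then P a else 0) else P a * F a),
      ← Finset.mul_prod_erase Finset.univ _ (Finset.mem_univ m),
      Finset.prod_congr (g := fun _ => ∑ a, P a * F a) rfl
        (fun i hi => by simp [Finset.ne_of_mem_erase hi])]
    simp
  have hind : ∀ (C : Fin M → ι) (y : ι),
      (if ∃ m', m' ≠ m ∧ R (C m') y then (1 : ℝ) else 0) =
        1 -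
          ∏ m' ∈ Finset.univ.erase m, (if R (C m') y then 0 else 1) := by
    intro C y
    split_ifs with h
    · obtain ⟨m', hm, hR⟩ := h
      rw [Finset.prod_eq_zero (i := m') (by simp [hm]) (by simp [hR])]
      simp
    · rw [Finset.prod_congr rfl fun m' hm' =>
        if_neg fun hR => h ⟨m', Finset.ne_of_mem_erase hm', hR⟩]
      simp
  calc _ = ∑ C : Fin M → ι, ∑ y, g y * ((if C m = y then ∏ i, P (C i) else 0) *
        ((∏ _m' ∈ Finset.univ.erase m, (1 : ℝ)) -
          ∏ m' ∈ Finset.univ.erase m, (if R (C m') y then 0 else 1))) := by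
        refine Finset.sum_congr rfl fun C _ => ?_
        rw [Finset.sum_eq_single (C m) (fun y _ hy => by simp [hy.symm]) (by simp), Finset.prod_const_one, ← hind]
        simp only [if_true]
        rw [mul_left_comm]
        congr!
    _ = ∑ y, g y * (P y * (∑ a, P a * 1) ^ (M - 1) -
          P y * (∑ a, P a * if R a y then 0 else 1) ^ (M - 1)) := by
        rw [Finset.sum_comm]
        refine Finset.sum_congr rfl fun y _ => ?_
        rw [← Finset.mul_sum]
        simp only [mul_sub, Finset.sum_sub_distrib]
        rw [hkey y (fun _ => 1), hkey y (fun a => if R a y then 0 else 1)]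
    _ = _ := by
        refine Finset.sum_congr rfl fun y _ => ?_
        have : ∑ a, P a * (if R a y then (0 : ℝ) else 1) =
            1 - ∑ a, P a * (if R a y then (1 : ℝ) else 0) := by
          rw [eq_sub_iff_add_eq, ← Finset.sum_add_distrib]
          exact .trans (Finset.sum_congr rfl fun a _ => by split_ifs <;> ring) hP1
        simp only [mul_one, hP1, one_pow, this, collisionProb]
        ring

variable {X Y Z Ω Θ S : Type*} [Fintype X] [Fintype Y] [Fintype Z]
  [Fintype Ω] [Fintype Θ] [Fintype S]

/-- By symmetry every message has the same expected error, so the factor 1/M disappears, and P(y)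
P(z|y) recombines to the joint law. -/
lemma avgError_eq (G : FSSource X Ω) (V : FSChannel X Y Θ) (W : FSChannel X Z S) {n M : ℕ}
    (hM : 0 < M) (hP : ∀ y : Fin n → Y, codeLaw G V y ≠ 0)
    (hP1 : ∑ y : Fin n → Y, codeLaw G V y = 1) (rank : (Fin n → Y) → (Fin n → Z) → ℕ) :
    avgError G V W M rank = ∑ z, ∑ y, jointLaw G V W y z *
      collisionProb (M - 1) (∑ y', codeLaw G V y' * if rank y' z ≤ rank y z then 1 else 0) := by
  classical
  have hM' : (M : ℝ) ≠ 0 := by exact_mod_cast hM.ne'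
  have h1 : ∀ (m : Fin M) (z : Fin n → Z),
      ∑ C : Fin M → Fin n → Y, (∏ i, codeLaw G V (C i)) * (inducedChannel G V W z (C m) *
        if ∃ m' : Fin M, m' ≠ m ∧ rank (C m') z ≤ rank (C m) z then 1 else 0) =
      ∑ y, jointLaw G V W y z *
        collisionProb (M - 1) (∑ y', codeLaw G V y' * if rank y' z ≤ rank y z then 1 else 0) := by
    intro m z
    rw [sum_prod_mul_exists (codeLaw G V) hP1 m (fun y => inducedChannel G V W z y)
      (fun y' y => rank y' z ≤ rank y z)]
    refine Finset.sum_congr rfl fun y _ => ?_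
    rw [inducedChannel, mul_div_cancel₀ _ (hP y)]
  calc avgError G V W M rank
      = 1 / (M : ℝ) * ∑ m : Fin M, ∑ z : Fin n → Z, ∑ C : Fin M → Fin n → Y,
        (∏ i, codeLaw G V (C i)) * (inducedChannel G V W z (C m) *
        if ∃ m' : Fin M, m' ≠ m ∧ rank (C m') z ≤ rank (C m) z then 1 else 0) := by
        simp only [avgError, codeError]
        simp_rw [mul_left_comm _ (1 / (M : ℝ)), ← Finset.mul_sum]
        congr 1
        simp_rw [Finset.mul_sum]
        rw [Finset.sum_comm]
        refine Finset.sum_congr rfl fun m _ => ?_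
        rw [Finset.sum_comm]
    _ = _ := by
        simp only [h1]
        simp [hM']

end ErrorFormula

/-! ### Multiplicities of phrases and permutations preserving labels. -/

section Multiplicity

variable {β : Type*} [DecidableEq β] {c : ℕ}

/-- The number of indices at which the family `u` takes the value `u j`. -/
def multiplicity (u : Fin c → β) (j : Fin c) : ℕ := (Finset.univ.filter fun i => u i = u j).card

lemma multiplicity_pos (u : Fin c → β) (j : Fin c) : 0 < multiplicity u j :=
  Finset.card_pos.2 ⟨j, by simp⟩

lemma count_ofFn {β : Type*} [BEq β] [LawfulBEq β] [DecidableEq β] (u : Fin c → β) (b : β) :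
    (List.ofFn u).count b = (Finset.univ.filter fun i => u i = b).card := by
  rw [Finset.card_filter]
  induction c with
  | zero => simp
  | succ c ih =>
    rw [List.ofFn_succ, List.count_cons, ih, Fin.sum_univ_succ, add_comm]
    simp

/-- Spreading c log c over the c positions of a value turns the LZ sum into a sum over positions. -/
lemma sum_count_mul_log {β : Type*} [BEq β] [LawfulBEq β] [DecidableEq β] (u : Fin c → β) :
    ∑ b ∈ (List.ofFn u).toFinset, ((List.ofFn u).count b : ℝ) * Real.log ((List.ofFn u).count b) =
      Real.log (∏ j, (multiplicity u j : ℝ)) := by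
  have h := Finset.sum_list_map_count (List.ofFn u)
    (fun b => Real.log ((List.ofFn u).count b))
  simp only [nsmul_eq_mul, count_ofFn] at h ⊢
  rw [← h, List.map_ofFn, List.sum_ofFn, Real.log_prod]
  · rfl
  · intro j _
    exact_mod_cast (multiplicity_pos u j).ne'

/-- A lower bound for the number of permutations that preserve two labellings. -/
lemma prod_multiplicity_le {K : Type*} [Fintype K] [DecidableEq K] (u : Fin c → β)
    (κ : Fin c → K) :
    ∏ j, (multiplicity u j : ℝ) ≤ (Real.exp 1 * Fintype.card K) ^ c *
      (Finset.univ.filter fun h : Equiv.Perm (Fin c) => u ∘ h = u ∧ κ ∘ h = κ).card := by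
  set G := Finset.univ.filter fun h : Equiv.Perm (Fin c) => u ∘ h = u with hG
  set H := Finset.univ.filter fun h : Equiv.Perm (Fin c) => u ∘ h = u ∧ κ ∘ h = κ with hH
  -- The stabilizer of `u` has ∏ N! elements and the left side is ∏ N^N, over the values of `u`; N^N
  -- ≤ e^N N! compares them.
  have h1 : ∏ j, (multiplicity u j : ℝ) ≤ Real.exp 1 ^ c * G.card := by
    have hGcard : G.card = ∏ b ∈ Finset.univ.image u,
        (Finset.univ.filter fun i => u i = b).card.factorial := by
      rw [hG, ← Fintype.card_subtype, DomMulAct.stabilizer_card']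
      simp only [Fintype.card_subtype]
    have hc : Real.exp 1 ^ c = ∏ b ∈ Finset.univ.image u,
        Real.exp 1 ^ (Finset.univ.filter fun i => u i = b).card := by
      rw [Finset.prod_pow_eq_pow_sum, ← Finset.card_eq_sum_card_image]; simp
    have hV : ∏ j, (multiplicity u j : ℝ) = ∏ b ∈ Finset.univ.image u,
        ((Finset.univ.filter fun i => u i = b).card : ℝ) ^
          (Finset.univ.filter fun i => u i = b).card :=
      Finset.prod_comp (fun b => ((Finset.univ.filter fun i => u i = b).card : ℝ)) u
    rw [hV, hGcard, hc, Nat.cast_prod, ← Finset.prod_mul_distrib]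
    refine Finset.prod_le_prod (fun b _ => by positivity) fun b _ => ?_
    set k := (Finset.univ.filter fun i => u i = b).card
    have := Real.pow_div_factorial_le_exp (k : ℝ) (by positivity) k
    rw [div_le_iff₀ (by exact_mod_cast Nat.factorial_pos k)] at this
    rwa [← Real.exp_nat_mul, mul_one]
  -- The map h ↦ κ ∘ h takes at most |K|^c values, and right multiplication by the inverse of one
  -- member embeds its fibre into `H`.
  have h2 : G.card ≤ H.card * Fintype.card K ^ c := by
    refine (Finset.card_le_mul_card_image (f := fun h : Equiv.Perm (Fin c) => κ ∘ h) G H.card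
      ?_).trans ?_
    · intro b hb
      obtain ⟨g, hg, rfl⟩ := Finset.mem_image.1 hb
      have hg' : u ∘ g = u := by simpa [hG] using hg
      refine Finset.card_le_card_of_injOn (fun h => h * g⁻¹) ?_ ?_
      · intro h hh
        simp only [hG, Finset.coe_filter, Finset.mem_filter, Finset.mem_univ, true_and,
          Set.mem_ofPred_eq] at hh
        simp only [hH, Finset.coe_filter, Finset.mem_univ, true_and, Set.mem_ofPred_eq]
        constructor
        · funext i
          have a1 := congrFun hh.1 (g⁻¹ i)
          have a2 := congrFun hg' (g⁻¹ i)
          simp at a1 a2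
          simp [a1, a2]
        · funext i
          have a1 := congrFun hh.2 (g⁻¹ i)
          simp at a1
          simp [a1]
      · intro a _ b _ hab
        simpa using hab
    · refine Nat.mul_le_mul_left _ ((Finset.card_le_univ _).trans ?_)
      simp
  calc ∏ j, (multiplicity u j : ℝ) ≤ Real.exp 1 ^ c * G.card := h1
    _ ≤ Real.exp 1 ^ c * (H.card * (Fintype.card K : ℝ) ^ c) := by
        gcongr; exact_mod_cast h2
    _ = _ := by rw [mul_pow]; ring

/-- Each word has at most `|Z|` one-letter extensions. -/
lemma sum_parents_div_multiplicity_le {Z : Type*} [Fintype Z] [DecidableEq Z]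
    (ζ : Fin c → List Z) (hne : ∀ j, ζ j ≠ []) :
    ∑ j, (((Finset.univ.filter fun i => ζ i = (ζ j).dropLast).card : ℝ) + 1) / multiplicity ζ j ≤
      (Fintype.card Z + 1) * c := by
  have hpos : ∀ j, (0 : ℝ) < multiplicity ζ j := fun j => by exact_mod_cast multiplicity_pos ζ j
  have h1 : ∑ j, (1 : ℝ) / multiplicity ζ j ≤ c := by
    calc _ ≤ ∑ _j : Fin c, (1 : ℝ) := Finset.sum_le_sum fun j _ => by
          rw [div_le_one (hpos j)]; exact_mod_cast multiplicity_pos ζ j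
      _ = c := by simp
  -- The j whose word extends `ζ i` by one letter take at most |Z| values, and the j sharing one
  -- value contribute at most 1 together.
  have h2 : ∀ i, ∑ j, (if ζ i = (ζ j).dropLast then (1 : ℝ) else 0) / multiplicity ζ j ≤
      Fintype.card Z := by
    intro i
    set J := Finset.univ.filter fun j => ζ i = (ζ j).dropLast with hJ
    have himg : (J.image ζ).card ≤ Fintype.card Z := by
      refine (Finset.card_le_card (t := Finset.univ.image fun a : Z => ζ i ++ [a]) ?_).trans
        (Finset.card_image_le.trans (by simp))
      intro w hw
      obtain ⟨j, hj, rfl⟩ := Finset.mem_image.1 hw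
      have hj' : ζ i = (ζ j).dropLast := by simpa [hJ] using hj
      refine Finset.mem_image.2 ⟨(ζ j).getLast (hne j), Finset.mem_univ _, ?_⟩
      rw [hj', List.dropLast_append_getLast]
    calc _ = ∑ j ∈ J, (1 : ℝ) / multiplicity ζ j := by
          rw [hJ, Finset.sum_filter]
          exact Finset.sum_congr rfl fun j _ => by split_ifs <;> simp
      _ = ∑ b ∈ J.image ζ, ∑ j ∈ J.filter fun j => ζ j = b, (1 : ℝ) / multiplicity ζ j :=
          (Finset.sum_fiberwise_of_maps_to (fun j hj => Finset.mem_image_of_mem ζ hj) _).symm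
      _ ≤ ∑ b ∈ J.image ζ, (1 : ℝ) := by
          refine Finset.sum_le_sum fun b hb => ?_
          obtain ⟨j₀, -, rfl⟩ := Finset.mem_image.1 hb
          calc _ = ∑ j ∈ J.filter fun j => ζ j = ζ j₀, (1 : ℝ) / multiplicity ζ j₀ := by
                refine Finset.sum_congr rfl fun j hj => ?_
                rw [multiplicity, multiplicity, (Finset.mem_filter.1 hj).2]
            _ ≤ 1 := by
                rw [Finset.sum_const, nsmul_eq_mul, mul_one_div, div_le_one (hpos j₀)]
                exact_mod_cast Finset.card_le_card
                  (Finset.filter_subset_filter _ (Finset.subset_univ J))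
      _ ≤ Fintype.card Z := by simpa using himg
  calc _ = (∑ i, ∑ j, (if ζ i = (ζ j).dropLast then (1 : ℝ) else 0) / multiplicity ζ j) +
        ∑ j, (1 : ℝ) / multiplicity ζ j := by
        rw [Finset.sum_comm, ← Finset.sum_add_distrib]
        refine Finset.sum_congr rfl fun j _ => ?_
        rw [← Finset.sum_div, add_div, Finset.sum_boole]
    _ ≤ (∑ _i : Fin c, (Fintype.card Z : ℝ)) + c :=
        add_le_add (Finset.sum_le_sum fun i _ => h2 i) h1
    _ = _ := by simp; ring

end Multiplicity

/-! ### Cutting sequences of pairs into segments of prescribed lengths. -/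

section Segments

variable {α : Type*}

/-- The `j`-th segment of `w` when it is cut into segments of lengths `τ`. -/
def segment (τ : List ℕ) (w : List α) (j : Fin τ.length) : List α :=
  (τ.splitLengths w)[j]'(by rw [List.length_splitLengths]; exact j.2)

lemma ofFn_segment (τ : List ℕ) (w : List α) : List.ofFn (segment τ w) = τ.splitLengths w := by
  apply List.ext_getElem
  · simp
  · intro i h1 h2
    simp [segment]

lemma flatten_segment {τ : List ℕ} {w : List α} (h : w.length = τ.sum) :
    (List.ofFn (segment τ w)).flatten = w := by
  rw [ofFn_segment, List.flatten_splitLengths _ _ h.le]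

lemma length_segment {τ : List ℕ} {w : List α} (h : w.length = τ.sum) (j : Fin τ.length) :
    (segment τ w j).length = τ[j] :=
  List.splitLengths_length_getElem w τ h.ge j _

/-- A list of words is determined by its concatenation and its word lengths. -/
lemma segment_flatten {τ : List ℕ} {u : Fin τ.length → List α} (hu : ∀ j, (u j).length = τ[j]) :
    segment τ (List.ofFn u).flatten = u := by
  have hlen : (List.ofFn u).map List.length = τ := by
    apply List.ext_getElem
    · simp
    · intro i h1 h2
      simpa using hu ⟨i, h2⟩
  have hw : (List.ofFn u).flatten.length = τ.sum := by rw [List.length_flatten, hlen]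
  apply List.ofFn_injective
  rw [List.eq_iff_flatten_eq]
  refine ⟨flatten_segment hw, ?_⟩
  rw [ofFn_segment, List.map_splitLengths_length _ _ hw.ge, hlen]

lemma map_segment {β : Type*} {τ : List ℕ} {w : List α} (h : w.length = τ.sum) (f : α → β)
    (j : Fin τ.length) : (segment τ w j).map f = segment τ (w.map f) j := by
  have h1 := segment_flatten (τ := τ) (u := fun j => (segment τ w j).map f)
    (fun j => by rw [List.length_map, length_segment h])
  have h2 : (List.ofFn fun j => (segment τ w j).map f).flatten = w.map f := by
    conv_rhs => rw [← flatten_segment h]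
    rw [List.map_flatten, List.map_ofFn]; rfl
  rw [h2] at h1
  rw [h1]

lemma segment_injective {τ : List ℕ} {w w' : List α} (h : w.length = τ.sum)
    (h' : w'.length = τ.sum) (heq : segment τ w = segment τ w') : w = w' := by
  rw [← flatten_segment h, heq, flatten_segment h']

variable {Y Z : Type*} {n : ℕ}

/-- The sequence of pairs `(y₁, z₁), …, (yₙ, zₙ)`. -/
def pairWord (y : Fin n → Y) (z : Fin n → Z) : List (Y × Z) := List.ofFn fun i => (y i, z i)

@[simp] lemma length_pairWord (y : Fin n → Y) (z : Fin n → Z) : (pairWord y z).length = n := by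
  simp [pairWord]

lemma map_snd_pairWord (y : Fin n → Y) (z : Fin n → Z) :
    (pairWord y z).map Prod.snd = List.ofFn z := by
  simp only [pairWord, List.map_ofFn]; rfl

lemma map_fst_pairWord (y : Fin n → Y) (z : Fin n → Z) :
    (pairWord y z).map Prod.fst = List.ofFn y := by
  simp only [pairWord, List.map_ofFn]; rfl

lemma pairWord_injective (z : Fin n → Z) : Function.Injective fun y : Fin n → Y => pairWord y z := by
  intro y y' h
  apply List.ofFn_injective
  rw [← map_fst_pairWord y z, ← map_fst_pairWord y' z]
  exact congrArg _ h

lemma exists_pairWord_eq (z : Fin n → Z) {w : List (Y × Z)} (hw : w.map Prod.snd = List.ofFn z) :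
    ∃ y : Fin n → Y, pairWord y z = w := by
  have hlen : w.length = n := by simpa using congrArg List.length hw
  refine ⟨fun i => (w[i]).1, ?_⟩
  apply List.ext_getElem
  · simp [hlen]
  · intro i h1 h2
    have h3 : (w.map Prod.snd)[i]'(by simpa using h2) = z ⟨i, hlen ▸ h2⟩ := by
      simp only [hw, List.getElem_ofFn]
    simp only [List.getElem_map] at h3
    simp [pairWord, ← h3]

lemma map_snd_segment_pairWord {τ : List ℕ} (hτ : τ.sum = n) (y : Fin n → Y) (z : Fin n → Z)
    (j : Fin τ.length) :
    (segment τ (pairWord y z) j).map Prod.snd = segment τ (List.ofFn z) j := by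
  rw [map_segment (by simp [hτ]), map_snd_pairWord]

/-- Exchanging phrases with equal z-part leaves z intact, so only y changes. The new y' need not
have phrase lengths `τ` in its own parsing. -/
lemma exists_segment_pairWord_comp {τ : List ℕ} (hτ : τ.sum = n) (y : Fin n → Y) (z : Fin n → Z)
    (h : Equiv.Perm (Fin τ.length)) (hz : segment τ (List.ofFn z) ∘ h = segment τ (List.ofFn z)) :
    ∃ y' : Fin n → Y, segment τ (pairWord y' z) = segment τ (pairWord y z) ∘ h := by
  have hmap : ∀ j, (segment τ (pairWord y z) (h j)).map Prod.snd = segment τ (List.ofFn z) j :=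
    fun j => (map_snd_segment_pairWord hτ y z (h j)).trans (congrFun hz j)
  obtain ⟨y', hy'⟩ := exists_pairWord_eq (Y := Y) z
    (w := (List.ofFn (segment τ (pairWord y z) ∘ h)).flatten) (by
      rw [List.map_flatten, List.map_ofFn]
      rw [show (List.map Prod.snd ∘ (segment τ (pairWord y z) ∘ h)) = segment τ (List.ofFn z) from
        funext hmap]
      exact flatten_segment (by simp [hτ]))
  refine ⟨y', ?_⟩
  rw [hy']
  refine segment_flatten fun j => ?_
  have := congrArg List.length (hmap j)
  rw [List.length_map, length_segment (w := List.ofFn z) (by simp [hτ])] at this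
  exact this

end Segments

/-! ### Counting code sequences by their joint parsing with z. -/

section ParsingClass

variable {Y Z : Type*} [DecidableEq Y] [DecidableEq Z] {n : ℕ}

/-- The list of phrase lengths of the joint incremental parsing. -/
def phraseLengths (y : Fin n → Y) (z : Fin n → Z) : List ℕ :=
  (lzParse (pairWord y z)).map List.length

lemma sum_phraseLengths (y : Fin n → Y) (z : Fin n → Z) : (phraseLengths y z).sum = n := by
  rw [phraseLengths, ← List.length_flatten, flatten_lzParse, length_pairWord]

lemma ofFn_segment_phraseLengths {τ : List ℕ} {y : Fin n → Y} {z : Fin n → Z}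
    (hτ : phraseLengths y z = τ) :
    List.ofFn (segment τ (pairWord y z)) = lzParse (pairWord y z) := by
  subst hτ
  have hsum := sum_phraseLengths y z
  rw [List.eq_iff_flatten_eq, flatten_segment (by simp [hsum]), flatten_lzParse, ofFn_segment,
    List.map_splitLengths_length _ _ (by simp [hsum])]
  exact ⟨rfl, rfl⟩

lemma exp_lzSum {τ : List ℕ} {y : Fin n → Y} {z : Fin n → Z} (hτ : phraseLengths y z = τ) :
    Real.exp (lzSum y z) = ∏ j, (multiplicity (segment τ (List.ofFn z)) j : ℝ) := by
  have hsum : τ.sum = n := hτ ▸ sum_phraseLengths y z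
  have h : zPhrases y z = List.ofFn (segment τ (List.ofFn z)) := by
    rw [zPhrases, ← pairWord, ← ofFn_segment_phraseLengths hτ, List.map_ofFn]
    congr 1
    funext j
    exact map_snd_segment_pairWord hsum y z j
  rw [lzSum, h, sum_count_mul_log, Real.exp_log]
  exact Finset.prod_pos fun j _ => by exact_mod_cast multiplicity_pos _ j

lemma segment_ne_nil {τ : List ℕ} {y : Fin n → Y} {z : Fin n → Z} (hτ : phraseLengths y z = τ)
    (j : Fin τ.length) : segment τ (pairWord y z) j ≠ [] := by
  apply (isIncremental_lzParse (pairWord y z)).ne_nil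
  rw [← ofFn_segment_phraseLengths hτ, List.mem_ofFn]
  exact ⟨j, rfl⟩

lemma segment_z_ne_nil {τ : List ℕ} {y : Fin n → Y} {z : Fin n → Z} (hτ : phraseLengths y z = τ)
    (j : Fin τ.length) : segment τ (List.ofFn z) j ≠ [] := by
  rw [← map_snd_segment_pairWord (hτ ▸ sum_phraseLengths y z) y z j]
  simpa using segment_ne_nil hτ j

lemma dropLast_segment {τ : List ℕ} {y : Fin n → Y} {z : Fin n → Z} (hτ : phraseLengths y z = τ)
    (j : Fin τ.length) : (segment τ (pairWord y z) j).dropLast = [] ∨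
      ∃ i < j, segment τ (pairWord y z) i = (segment τ (pairWord y z) j).dropLast := by
  have hinc := isIncremental_lzParse (pairWord y z)
  rw [← ofFn_segment_phraseLengths hτ] at hinc
  have := hinc.dropLast_mem j (by simp)
  rw [List.getElem_ofFn] at this
  refine this.imp id fun h => ?_
  obtain ⟨i, hi, hij⟩ := List.getElem_of_mem h
  rw [List.length_take] at hi
  refine ⟨⟨i, by simp at hi; omega⟩, ?_, ?_⟩
  · rw [Fin.lt_def]; exact (lt_min_iff.1 hi).1
  · rw [← hij, List.getElem_take, List.getElem_ofFn]

/-- All phrases except possibly the last one are distinct. -/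
lemma segment_injOn {τ : List ℕ} {y : Fin n → Y} {z : Fin n → Z} (hτ : phraseLengths y z = τ)
    {i j : Fin τ.length} (hi : i.1 + 1 < τ.length) (hj : j.1 + 1 < τ.length)
    (h : segment τ (pairWord y z) i = segment τ (pairWord y z) j) : i = j := by
  have hinc := (isIncremental_lzParse (pairWord y z)).nodup_dropLast
  rw [← ofFn_segment_phraseLengths hτ] at hinc
  have h1 := (List.Nodup.getElem_inj_iff hinc (i := i.1) (j := j.1) (hi := by simp; omega)
    (hj := by simp; omega)).1 (by simpa using h)
  exact Fin.ext h1

/-- The number of sequences with given phrase lengths, given the side information. -/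
lemma card_phraseLengths_eq_le [Fintype Y] [Nonempty Y] [Fintype Z] (z : Fin n → Z) (τ : List ℕ) :
    ((Finset.univ.filter fun y : Fin n → Y => phraseLengths y z = τ).card : ℝ) ≤
      (Fintype.card Y * Real.exp (Fintype.card Z + 1)) ^ τ.length *
        ∏ j, (multiplicity (segment τ (List.ofFn z)) j : ℝ) := by
  set ζ := segment τ (List.ofFn z) with hζ
  set E := Finset.univ.filter fun y : Fin n → Y => phraseLengths y z = τ with hE
  have hV : 0 ≤ ∏ j, (multiplicity ζ j : ℝ) := Finset.prod_nonneg fun j _ => by positivity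
  rcases E.eq_empty_or_nonempty with he | ⟨y₀, hy₀⟩
  · rw [he]; simp only [Finset.card_empty, Nat.cast_zero]; positivity
  have hEτ : ∀ y ∈ E, phraseLengths y z = τ := fun y hy => (Finset.mem_filter.1 hy).2
  have hsum : τ.sum = n := hEτ y₀ hy₀ ▸ sum_phraseLengths y₀ z
  have hne : ∀ j, ζ j ≠ [] := segment_z_ne_nil (hEτ y₀ hy₀)
  -- A phrase is encoded by a pointer to the earlier phrase it extends (`none` for the empty word)
  -- and its last y-letter. As z is known, the pointer must target a position whose z-phrase is the
  -- truncated one.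
  let allowed : Fin τ.length → Finset (Option (Fin τ.length) × Y) := fun j =>
    (insert none ((Finset.univ.filter fun i => ζ i = (ζ j).dropLast).image some)) ×ˢ Finset.univ
  have hcode : ∀ y : Fin n → Y, y ∈ E → ∀ j, ∃ q ∈ allowed j, (∀ i, q.1 = some i → i < j) ∧
      ∃ b, segment τ (pairWord y z) j =
        q.1.elim [] (segment τ (pairWord y z)) ++ [(q.2, b)] := by
    intro y hy j
    have hτ := hEτ y hy
    have hlast := List.dropLast_append_getLast (segment_ne_nil hτ j)
    set l := (segment τ (pairWord y z) j).getLast (segment_ne_nil hτ j)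
    rcases dropLast_segment hτ j with h | ⟨i, hij, h⟩
    · refine ⟨(none, l.1), by simp [allowed], by simp, l.2, ?_⟩
      rw [h] at hlast
      simpa using hlast.symm
    · refine ⟨(some i, l.1), ?_, ?_, l.2, ?_⟩
      · simp only [allowed, Finset.mem_product, Finset.mem_insert, Finset.mem_image,
          Finset.mem_filter, Finset.mem_univ, true_and, and_true]
        refine Or.inr ⟨i, ?_, rfl⟩
        rw [hζ, ← map_snd_segment_pairWord hsum y z i, h, ← map_snd_segment_pairWord hsum y z j,
          List.map_dropLast]
      · rintro i' h'
        simpa using (Option.some_inj.1 h') ▸ hij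
      · rw [← h] at hlast
        exact hlast.symm
  choose! code hmem hlt hb using hcode
  -- Pointers go strictly backwards, so phrases are decoded by induction on the position; the final
  -- z-letter is read off z.
  have hinj : Set.InjOn code E := by
    intro y hy y' hy' h
    have key : ∀ j, segment τ (pairWord y z) j = segment τ (pairWord y' z) j := by
      intro j
      induction j using WellFoundedLT.induction with
      | _ j ih =>
        obtain ⟨b, hbj⟩ := hb y hy j
        obtain ⟨b', hbj'⟩ := hb y' hy' j
        have hprev : (code y j).1.elim [] (segment τ (pairWord y z)) =
            (code y j).1.elim [] (segment τ (pairWord y' z)) := by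
          rcases hq : (code y j).1 with _ | i
          · rfl
          · exact ih i (hlt y hy j i hq)
        rw [← h, ← hprev] at hbj'
        have hs := (map_snd_segment_pairWord hsum y z j).trans
          (map_snd_segment_pairWord hsum y' z j).symm
        rw [hbj, hbj'] at hs
        have hbb : b = b' := by simpa using hs
        rw [hbj, hbj', hbb]
    exact pairWord_injective z (segment_injective (by simp [hsum]) (by simp [hsum]) (funext key))
  have hcard : E.card ≤ ∏ j, (allowed j).card := by
    rw [← Fintype.card_piFinset]
    exact Finset.card_le_card_of_injOn code
      (fun y hy => Fintype.mem_piFinset.2 fun j => hmem y hy j) hinj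
  set π : Fin τ.length → ℝ := fun j =>
    ((Finset.univ.filter fun i => ζ i = (ζ j).dropLast).card : ℝ) + 1 with hπ
  have hallowed : ∀ j, ((allowed j).card : ℝ) ≤
      Fintype.card Y * (multiplicity ζ j * Real.exp (π j / multiplicity ζ j)) := by
    intro j
    have hN : (0 : ℝ) < multiplicity ζ j := by exact_mod_cast multiplicity_pos ζ j
    have h1 : ((allowed j).card : ℝ) ≤ π j * Fintype.card Y := by
      simp only [allowed, Finset.card_product, Nat.cast_mul, Finset.card_univ, hπ]
      gcongr
      exact_mod_cast (Finset.card_insert_le _ _).trans (Nat.succ_le_succ Finset.card_image_le)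
    -- Using x ≤ e^x with x = π/N replaces the number of pointers by the multiplicity N; the
    -- exponents π/N add up to at most (|Z| + 1) times the number of phrases.
    have h2 : π j ≤ multiplicity ζ j * Real.exp (π j / multiplicity ζ j) := by
      calc π j = multiplicity ζ j * (π j / multiplicity ζ j) := by field_simp
        _ ≤ _ := by
          gcongr
          linarith [Real.add_one_le_exp (π j / multiplicity ζ j)]
    calc _ ≤ π j * Fintype.card Y := h1
      _ ≤ _ := by rw [mul_comm]; gcongr
  calc (E.card : ℝ) ≤ ∏ j, ((allowed j).card : ℝ) := by exact_mod_cast hcard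
    _ ≤ ∏ j, (Fintype.card Y * (multiplicity ζ j * Real.exp (π j / multiplicity ζ j))) :=
        Finset.prod_le_prod (fun j _ => by positivity) fun j _ => hallowed j
    _ = (Fintype.card Y : ℝ) ^ τ.length * ((∏ j, (multiplicity ζ j : ℝ)) *
          Real.exp (∑ j, π j / multiplicity ζ j)) := by
        rw [Finset.prod_mul_distrib, Finset.prod_mul_distrib, Real.exp_sum]; simp
    _ ≤ (Fintype.card Y : ℝ) ^ τ.length * ((∏ j, (multiplicity ζ j : ℝ)) *
          Real.exp ((Fintype.card Z + 1) * τ.length)) := by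
        gcongr
        exact sum_parents_div_multiplicity_le ζ hne
    _ = _ := by
        rw [mul_pow, ← Real.exp_nat_mul, mul_comm (τ.length : ℝ)]; ring

/-- A Kraft-type inequality for the conditional parsing. -/
lemma sum_exp_neg_lzSum_le [Fintype Y] [Nonempty Y] [Fintype Z] (z : Fin n → Z) {k : ℕ} {T : ℝ}
    (hk : ∀ y : Fin n → Y, (phraseLengths y z).length ≤ k)
    (hT : ((Finset.univ.image fun y : Fin n → Y => phraseLengths y z).card : ℝ) ≤ T) :
    ∑ y : Fin n → Y, Real.exp (-lzSum y z) ≤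
      T * (Fintype.card Y * Real.exp (Fintype.card Z + 1)) ^ k := by
  set B : ℝ := Fintype.card Y * Real.exp (Fintype.card Z + 1) with hB
  have hB1 : 1 ≤ B := by
    have h1 : (1 : ℝ) ≤ Fintype.card Y := by exact_mod_cast Fintype.card_pos
    have h2 : (1 : ℝ) ≤ Real.exp (Fintype.card Z + 1) := Real.one_le_exp (by positivity)
    nlinarith
  rw [← Finset.sum_fiberwise_of_maps_to (s := Finset.univ)
    (t := Finset.univ.image fun y : Fin n → Y => phraseLengths y z)
    (g := fun y => phraseLengths y z) (fun y _ => Finset.mem_image_of_mem _ (Finset.mem_univ y))]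
  calc _ ≤ ∑ τ ∈ Finset.univ.image fun y : Fin n → Y => phraseLengths y z, B ^ k := by
        refine Finset.sum_le_sum fun τ hτ => ?_
        obtain ⟨y₀, -, hy₀⟩ := Finset.mem_image.1 hτ
        have hV : 0 < ∏ j, (multiplicity (segment τ (List.ofFn z)) j : ℝ) :=
          Finset.prod_pos fun j _ => by exact_mod_cast multiplicity_pos _ j
        -- Given z, the LZ sum depends on y only through the phrase lengths, so it is constant on
        -- the class.
        calc _ = ∑ y ∈ Finset.univ.filter fun y : Fin n → Y => phraseLengths y z = τ,
              (∏ j, (multiplicity (segment τ (List.ofFn z)) j : ℝ))⁻¹ := by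
              refine Finset.sum_congr rfl fun y hy => ?_
              rw [Real.exp_neg, exp_lzSum (Finset.mem_filter.1 hy).2]
          _ ≤ B ^ τ.length := by
              rw [Finset.sum_const, nsmul_eq_mul, mul_inv_le_iff₀ hV]
              exact card_phraseLengths_eq_le z τ
          _ ≤ B ^ k := pow_le_pow_right₀ hB1 (hy₀ ▸ hk y₀)
    _ ≤ T * B ^ k := by
        rw [Finset.sum_const, nsmul_eq_mul]
        gcongr

end ParsingClass

/-! ### Comparison of two decoders for one channel output. -/

section Comparison

variable {Y Z : Type*} [DecidableEq Y] [DecidableEq Z] {n : ℕ}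
  {ρ σ : Type*} [Fintype ρ] [DecidableEq ρ] [Fintype σ] [DecidableEq σ]

/-- Rate of the exponential loss per phrase in the size of a class of permuted sequences. -/
noncomputable def phraseLoss (p : ℝ) (a b : ℕ) : ℝ := p ^ 4 / a / (Real.exp 1 * (b * b * 2))

lemma wordWeight_nonneg {α : Type*} {K : α → Matrix σ σ ℝ} (hK : ∀ a s t, 0 ≤ K a s t) (s₀ : σ)
    (w : List α) : 0 ≤ wordWeight K s₀ w :=
  Finset.sum_nonneg fun _ _ => wordMatrix_nonneg hK _ _ _

/-- The sequences obtained from `y` by permuting phrases in such a way that `z` and the transitions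
of the path `s` are unchanged: they are numerous and about as probable as `y`. -/
lemma exists_permuted_class {z : Fin n → Z} {τ : List ℕ} (hτ : τ.sum = n)
    (s₀ : σ) (s : Fin τ.length → σ) {A : Y × Z → Matrix σ σ ℝ} :
    ∃ (H : Finset (Equiv.Perm (Fin τ.length))) (act : Equiv.Perm (Fin τ.length) →
      (Fin n → Y) → Fin n → Y), H.Nonempty ∧
      ∏ j, (multiplicity (segment τ (List.ofFn z)) j : ℝ) ≤
        (Real.exp 1 * (Fintype.card σ * Fintype.card σ * 2)) ^ τ.length * H.card ∧
      (∀ h ∈ H, ∀ y, segment τ (pairWord (act h y) z) = segment τ (pairWord y z) ∘ h) ∧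
      (∀ h ∈ H, ∀ y, ∏ j, wordMatrix A (segment τ (pairWord (act h y) z) j) (prevState s₀ s j) (s j)
        = ∏ j, wordMatrix A (segment τ (pairWord y z) j) (prevState s₀ s j) (s j)) ∧
      (∀ h ∈ H, Function.Injective (act h)) ∧
      ∀ y, phraseLengths y z = τ → Set.InjOn (fun h => act h y) H := by
  set u := segment τ (List.ofFn z) with hu
  -- The labels are the states at both ends of a phrase and whether the phrase is the last; their
  -- number |σ|² · 2 enters `phraseLoss`. The last phrase may repeat an earlier one, so it is kept
  -- in place for distinct permutations to give distinct sequences.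
  let κ : Fin τ.length → σ × σ × Bool := fun j =>
    (prevState s₀ s j, s j, decide (j.1 + 1 < τ.length))
  set H := Finset.univ.filter fun h : Equiv.Perm (Fin τ.length) => u ∘ h = u ∧ κ ∘ h = κ with hH
  have hHu : ∀ h ∈ H, u ∘ h = u := fun h hh => (Finset.mem_filter.1 hh).2.1
  have hHκ : ∀ h ∈ H, ∀ j, κ (h j) = κ j := fun h hh j => congrFun (Finset.mem_filter.1 hh).2.2 j
  have hex : ∀ (h : Equiv.Perm (Fin τ.length)) (y : Fin n → Y), ∃ y' : Fin n → Y,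
      h ∈ H → segment τ (pairWord y' z) = segment τ (pairWord y z) ∘ h := by
    intro h y
    by_cases hh : h ∈ H
    · obtain ⟨y', hy'⟩ := exists_segment_pairWord_comp hτ y z h (hHu h hh)
      exact ⟨y', fun _ => hy'⟩
    · exact ⟨y, fun h' => absurd h' hh⟩
  choose act hact using hex
  have hact' : ∀ h ∈ H, ∀ y, segment τ (pairWord (act h y) z) = segment τ (pairWord y z) ∘ h :=
    fun h hh y => hact h y hh
  refine ⟨H, act, ⟨1, by simp [hH]⟩, ?_, hact', ?_, ?_, ?_⟩
  · have := prod_multiplicity_le u κ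
    simpa [mul_assoc] using this
  · intro h hh y
    rw [hact' h hh y, ← Equiv.prod_comp h fun j =>
      wordMatrix A (segment τ (pairWord y z) j) (prevState s₀ s j) (s j)]
    refine Finset.prod_congr rfl fun j _ => ?_
    have h1 := hHκ h hh j
    simp only [κ, Prod.mk.injEq] at h1
    rw [h1.1, h1.2.1, Function.comp_apply]
  · intro h hh y y' heq
    apply pairWord_injective z
    apply segment_injective (τ := τ) (by simp [hτ]) (by simp [hτ])
    have h1 := hact' h hh y
    rw [heq, hact' h hh y'] at h1
    exact (h.surjective.injective_comp_right h1).symm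
  · intro y hy h hh h' hh' heq
    have h1 : segment τ (pairWord y z) ∘ h = segment τ (pairWord y z) ∘ h' := by
      rw [← hact' h hh y, ← hact' h' hh' y]
      exact congrArg (fun y => segment τ (pairWord y z)) heq
    have hlast : ∀ g ∈ H, ∀ j, (g j).1 + 1 < τ.length ↔ j.1 + 1 < τ.length := by
      intro g hg j
      have h1 := hHκ g hg j
      simp only [κ, Prod.mk.injEq, decide_eq_decide] at h1
      exact h1.2.2
    ext j
    by_cases hj : j.1 + 1 < τ.length
    · exact congrArg Fin.val (segment_injOn hy ((hlast h hh j).2 hj) ((hlast h' hh' j).2 hj)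
        (congrFun h1 j))
    · have a1 := (hlast h hh j).not.2 hj
      have a2 := (hlast h' hh' j).not.2 hj
      omega

variable [Fintype Y] {B : Y → Matrix ρ ρ ℝ} {A : Y × Z → Matrix σ σ ℝ} {p : ℝ}

/-- Along a fixed boundary path, the joint weight is the same for all permuted versions of y, so the
error at y may be averaged over that class, where half of the class precedes an average member. The
first conjunct keeps the argument of `collisionProb` in the range where `collisionProb_le_mul`
applies. -/
lemma sum_pathWeight_le (hp : 0 < p) (hB : ∀ a s t, p ≤ B a s t)
    (hB1 : ∀ s, ∑ a, ∑ t, B a s t = 1) (hA : ∀ a s t, 0 ≤ A a s t) (r₀ : ρ) (s₀ : σ)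
    (z : Fin n → Z) {τ : List ℕ} (hτ : τ.sum = n) (s : Fin τ.length → σ) (m : ℕ)
    (rank : (Fin n → Y) → ℕ) :
    (∀ y : Fin n → Y, phraseLengths y z = τ →
      phraseLoss p (Fintype.card ρ) (Fintype.card σ) ^ τ.length *
        Real.exp (lzSum y z) * wordWeight B r₀ (List.ofFn y) ≤ 1) ∧
    ∑ y ∈ Finset.univ.filter fun y : Fin n → Y => phraseLengths y z = τ,
      (∏ j, wordMatrix A (segment τ (pairWord y z) j) (prevState s₀ s j) (s j)) *
        collisionProb m (phraseLoss p (Fintype.card ρ) (Fintype.card σ) ^ τ.length *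
          Real.exp (lzSum y z) * wordWeight B r₀ (List.ofFn y)) ≤
    2 * ∑ y : Fin n → Y,
      (∏ j, wordMatrix A (segment τ (pairWord y z) j) (prevState s₀ s j) (s j)) *
        collisionProb m (∑ y' : Fin n → Y, wordWeight B r₀ (List.ofFn y') *
          if rank y' ≤ rank y then 1 else 0) := by
  have hB0 : ∀ a s t, 0 ≤ B a s t := fun a s t => hp.le.trans (hB a s t)
  have hP0 : ∀ y : Fin n → Y, 0 ≤ wordWeight B r₀ (List.ofFn y) :=
    fun y => wordWeight_nonneg hB0 _ _
  have hP1 := sum_wordWeight_ofFn hB1 r₀ n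
  set P : (Fin n → Y) → ℝ := fun y => wordWeight B r₀ (List.ofFn y) with hP
  set w : (Fin n → Y) → ℝ := fun y =>
    ∏ j, wordMatrix A (segment τ (pairWord y z) j) (prevState s₀ s j) (s j) with hw
  set g : (Fin n → Y) → ℝ := fun y =>
    collisionProb m (∑ y' : Fin n → Y, P y' * if rank y' ≤ rank y then 1 else 0) with hg
  have hw0 : ∀ y, 0 ≤ w y := fun y => Finset.prod_nonneg fun j _ => wordMatrix_nonneg hA _ _ _
  have hg0 : ∀ y, 0 ≤ g y := by
    intro y
    refine collisionProb_nonneg m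
      (Finset.sum_nonneg fun y' _ => mul_nonneg (hP0 y') (by split_ifs <;> norm_num)) ?_
    refine (Finset.sum_le_sum fun y' _ => ?_).trans_eq hP1
    exact mul_le_of_le_one_right (hP0 y') (by split_ifs <;> norm_num)
  obtain ⟨H, act, hHne, hHcard, hseg, hinv, hinj, hfree⟩ :=
    exists_permuted_class (Y := Y) (z := z) hτ s₀ s (A := A)
  have hHpos : (0 : ℝ) < H.card := by exact_mod_cast hHne.card_pos
  have hρ : (0 : ℝ) < Fintype.card ρ := by exact_mod_cast Fintype.card_pos_iff.2 ⟨r₀⟩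
  have hσ : (0 : ℝ) < Fintype.card σ := by exact_mod_cast Fintype.card_pos_iff.2 ⟨s₀⟩
  have hpt : ∀ y : Fin n → Y, phraseLengths y z = τ →
      phraseLoss p (Fintype.card ρ) (Fintype.card σ) ^ τ.length *
        Real.exp (lzSum y z) * P y ≤ 1 ∧
      (H.card : ℝ) * collisionProb m (phraseLoss p (Fintype.card ρ) (Fintype.card σ) ^ τ.length *
          Real.exp (lzSum y z) * P y) ≤ 2 * ∑ h ∈ H, g (act h y) := by
    intro y hyτ
    have hfst : ∀ y : Fin n → Y, List.ofFn y =
        (List.ofFn fun j => (segment τ (pairWord y z) j).map Prod.fst).flatten := by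
      intro y
      rw [← map_fst_pairWord y z]
      conv_lhs => rw [← flatten_segment (τ := τ) (w := pairWord y z) (by simp [hτ])]
      rw [List.map_flatten, List.map_ofFn]; rfl
    have hcomp : ∀ h ∈ H, (p ^ 4 / Fintype.card ρ) ^ τ.length * P y ≤ P (act h y) := by
      intro h hh
      have := wordWeight_perm_le hp hB (kernel_le_one hB0 hB1) r₀
        (w := fun j => (segment τ (pairWord y z) j).map Prod.fst)
        (fun j => by simpa using segment_ne_nil hyτ j) h
      rw [← hfst y] at this
      simp only [hP]
      rw [hfst (act h y), hseg h hh y]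
      exact this
    set b := (p ^ 4 / Fintype.card ρ) ^ τ.length * P y with hb
    have hb0 : 0 ≤ b := mul_nonneg (by positivity) (hP0 y)
    set D := H.image fun h => act h y with hD
    have hDcard : D.card = H.card := Finset.card_image_of_injOn (hfree y hyτ)
    have hDb : ∀ y' ∈ D, b ≤ P y' := by
      intro y' hy'
      obtain ⟨h, hh, rfl⟩ := Finset.mem_image.1 hy'
      exact hcomp h hh
    have hhalf := half_collisionProb_le_sum m P hP0 hP1 rank D b hb0 hDb
    rw [hD, Finset.sum_image (hfree y hyτ), ← hD, hDcard] at hhalf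
    have hone : (H.card : ℝ) * b ≤ 1 := by
      rw [← hDcard, ← nsmul_eq_mul]
      exact (Finset.card_nsmul_le_sum _ _ _ hDb).trans
        (hP1 ▸ Finset.sum_le_univ_sum_of_nonneg hP0)
    have hmono : phraseLoss p (Fintype.card ρ) (Fintype.card σ) ^ τ.length * Real.exp (lzSum y z) * P y ≤
        H.card * b := by
      rw [exp_lzSum hyτ, phraseLoss, div_pow, hb, ← mul_assoc (H.card : ℝ)]
      refine mul_le_mul_of_nonneg_right ?_ (hP0 y)
      rw [div_mul_eq_mul_div, div_le_iff₀ (by positivity)]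
      calc _ ≤ (p ^ 4 / Fintype.card ρ) ^ τ.length *
            ((Real.exp 1 * (Fintype.card σ * Fintype.card σ * 2)) ^ τ.length * H.card) := by gcongr
        _ = _ := by ring
    have := collisionProb_mono m hmono hone
    exact ⟨hmono.trans hone, by nlinarith⟩
  -- The permuted sequences may leave the class of `τ`, but each permutation acts injectively, so
  -- its image sum is bounded by the sum over all sequences.
  have hsum : ∀ h ∈ H, ∑ y ∈ Finset.univ.filter fun y : Fin n → Y => phraseLengths y z = τ,
      w y * g (act h y) ≤ ∑ y, w y * g y := by
    intro h hh
    calc _ = ∑ y ∈ Finset.univ.filter fun y : Fin n → Y => phraseLengths y z = τ,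
          w (act h y) * g (act h y) :=
          Finset.sum_congr rfl fun y _ => by rw [hw]; simp only [hinv h hh y]
      _ = ∑ y ∈ (Finset.univ.filter fun y : Fin n → Y => phraseLengths y z = τ).image (act h),
          w y * g y := by
          rw [Finset.sum_image (hinj h hh).injOn]
      _ ≤ _ := Finset.sum_le_univ_sum_of_nonneg fun y => mul_nonneg (hw0 y) (hg0 y)
  refine ⟨fun y hy => (hpt y hy).1, le_of_mul_le_mul_left ?_ hHpos⟩
  calc _ = ∑ y ∈ Finset.univ.filter fun y : Fin n → Y => phraseLengths y z = τ,
        w y * (H.card * collisionProb m (phraseLoss p (Fintype.card ρ) (Fintype.card σ) ^ τ.length *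
          Real.exp (lzSum y z) * P y)) := by
        rw [Finset.mul_sum]
        exact Finset.sum_congr rfl fun y _ => by ring
    _ ≤ ∑ y ∈ Finset.univ.filter fun y : Fin n → Y => phraseLengths y z = τ,
        w y * (2 * ∑ h ∈ H, g (act h y)) :=
        Finset.sum_le_sum fun y hy => mul_le_mul_of_nonneg_left (hpt y (Finset.mem_filter.1 hy).2).2 (hw0 y)
    _ = 2 * ∑ h ∈ H, ∑ y ∈ Finset.univ.filter fun y : Fin n → Y => phraseLengths y z = τ,
        w y * g (act h y) := by
        rw [Finset.sum_comm, Finset.mul_sum]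
        refine Finset.sum_congr rfl fun y _ => ?_
        rw [← Finset.mul_sum]; ring
    _ ≤ 2 * ∑ h ∈ H, ∑ y, w y * g y := by
        gcongr with h hh
        exact hsum h hh
    _ = _ := by rw [Finset.sum_const, nsmul_eq_mul]; ring

/-- Comparison, for one channel output, of the error of a decoder whose ranking respects the metric
`log P(y) + v(y, z)` with that of an arbitrary decoder. -/
lemma sum_collisionProb_le [Nonempty Y] [Fintype Z] (hp : 0 < p) (hp1 : p ≤ 1) (hB : ∀ a s t, p ≤ B a s t)
    (hB1 : ∀ s, ∑ a, ∑ t, B a s t = 1) (hA : ∀ a s t, 0 ≤ A a s t) (r₀ : ρ) (s₀ : σ)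
    (z : Fin n → Z) {k : ℕ} {T : ℝ}
    (hk : ∀ y : Fin n → Y, (phraseLengths y z).length ≤ k)
    (hT : ((Finset.univ.image fun y : Fin n → Y => phraseLengths y z).card : ℝ) ≤ T)
    (m : ℕ) (rank ranku : (Fin n → Y) → ℕ)
    (hP : ∀ y : Fin n → Y, 0 < wordWeight B r₀ (List.ofFn y))
    (hu : ∀ y y' : Fin n → Y, ranku y' ≤ ranku y →
      Real.log (wordWeight B r₀ (List.ofFn y')) + lzSum y' z ≤
        Real.log (wordWeight B r₀ (List.ofFn y)) + lzSum y z) :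
    ∑ y : Fin n → Y, wordWeight A s₀ (pairWord y z) *
        collisionProb m (∑ y' : Fin n → Y, wordWeight B r₀ (List.ofFn y') *
          if ranku y' ≤ ranku y then 1 else 0) ≤
      2 * T ^ 2 * (Fintype.card Y * Real.exp (Fintype.card Z + 1) /
        phraseLoss p (Fintype.card ρ) (Fintype.card σ)) ^ k *
      ∑ y : Fin n → Y, wordWeight A s₀ (pairWord y z) *
        collisionProb m (∑ y' : Fin n → Y, wordWeight B r₀ (List.ofFn y') *
          if rank y' ≤ rank y then 1 else 0) := by
  have hB0 : ∀ a s t, 0 ≤ B a s t := fun a s t => hp.le.trans (hB a s t)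
  have hP1 := sum_wordWeight_ofFn hB1 r₀ n
  set P : (Fin n → Y) → ℝ := fun y => wordWeight B r₀ (List.ofFn y) with hPdef
  set 𝒯 := Finset.univ.image fun y : Fin n → Y => phraseLengths y z with h𝒯
  set β : ℝ := Fintype.card Y * Real.exp (Fintype.card Z + 1) with hβ
  set l := phraseLoss p (Fintype.card ρ) (Fintype.card σ) with hl
  have hρ : (1 : ℝ) ≤ Fintype.card ρ := by exact_mod_cast Fintype.card_pos_iff.2 ⟨r₀⟩
  have hσ : (1 : ℝ) ≤ Fintype.card σ := by exact_mod_cast Fintype.card_pos_iff.2 ⟨s₀⟩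
  have hl0 : 0 < l := by rw [hl, phraseLoss]; positivity
  have hl1 : l ≤ 1 := by
    rw [hl, phraseLoss, div_div]
    refine div_le_one_of_le₀ ((pow_le_one₀ hp.le hp1).trans ?_) (by positivity)
    have he : (1 : ℝ) ≤ Real.exp 1 := Real.one_le_exp zero_le_one
    have h1 : (1 : ℝ) ≤ Fintype.card σ * Fintype.card σ * 2 := by nlinarith
    exact one_le_mul_of_one_le_of_one_le hρ (one_le_mul_of_one_le_of_one_le he h1)
  have hβ1 : 1 ≤ β := by
    have h1 : (1 : ℝ) ≤ Fintype.card Y := by exact_mod_cast Fintype.card_pos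
    exact one_le_mul_of_one_le_of_one_le h1 (Real.one_le_exp (by positivity))
  have hT1 : 1 ≤ T := by
    refine le_trans ?_ hT
    exact_mod_cast Finset.card_pos.2 (Finset.univ_nonempty.image _)
  have hKraft := sum_exp_neg_lzSum_le z hk hT
  rw [← hβ] at hKraft
  -- Ratio between the Kraft bound for the universal decoder and the mass guaranteed by the permuted
  -- class.
  set L : ℝ := T * β ^ k / l ^ k with hL
  have hL1 : 1 ≤ L := by
    rw [hL, le_div_iff₀ (pow_pos hl0 k), one_mul]
    exact (pow_le_one₀ hl0.le hl1).trans
      (one_le_mul_of_one_le_of_one_le hT1 (one_le_pow₀ hβ1))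
  set q : (Fin n → Y) → ℝ := fun y =>
    ∑ y' : Fin n → Y, P y' * if ranku y' ≤ ranku y then 1 else 0 with hq
  set qo : (Fin n → Y) → ℝ := fun y =>
    ∑ y' : Fin n → Y, P y' * if rank y' ≤ rank y then 1 else 0 with hqo
  have hq1 : ∀ y, q y ≤ 1 := fun y => (Finset.sum_le_sum fun y' _ =>
    mul_le_of_le_one_right (hP y').le (by split_ifs <;> norm_num)).trans_eq hP1
  -- Each competitor ranked no later has P(y') ≤ e^{-v(y')} e^{v(y)} P(y); for the others the
  -- summand is 0. Kraft sums the bounds.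
  have hqle : ∀ y, q y ≤ T * β ^ k * (Real.exp (lzSum y z) * P y) := by
    intro y
    calc q y ≤ ∑ y', Real.exp (-lzSum y' z) * (Real.exp (lzSum y z) * P y) := by
          refine Finset.sum_le_sum fun y' _ => ?_
          split_ifs with h
          · have h1 := Real.exp_le_exp.2 (hu y y' h)
            rw [Real.exp_add, Real.exp_add, Real.exp_log (hP y'), Real.exp_log (hP y)] at h1
            rw [mul_one, Real.exp_neg, ← div_eq_inv_mul, le_div_iff₀ (Real.exp_pos _)]
            exact h1.trans_eq (mul_comm _ _)
          · have := hP y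
            rw [mul_zero]; positivity
      _ ≤ _ := by
          rw [← Finset.sum_mul]
          have := hP y
          gcongr
  have hw0 : ∀ (τ : List ℕ) (s : Fin τ.length → σ) (y : Fin n → Y),
      0 ≤ ∏ j, wordMatrix A (segment τ (pairWord y z) j) (prevState s₀ s j) (s j) :=
    fun τ s y => Finset.prod_nonneg fun j _ => wordMatrix_nonneg hA _ _ _
  have hA_seg : ∀ (τ : List ℕ), τ.sum = n → ∀ y : Fin n → Y, wordWeight A s₀ (pairWord y z) =
      ∑ s : Fin τ.length → σ,
        ∏ j, wordMatrix A (segment τ (pairWord y z) j) (prevState s₀ s j) (s j) := by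
    intro τ hτ y
    rw [← wordWeight_flatten, flatten_segment (by simp [hτ])]
  have hclass : ∀ τ ∈ 𝒯, ∑ y ∈ Finset.univ.filter fun y : Fin n → Y => phraseLengths y z = τ,
      wordWeight A s₀ (pairWord y z) * collisionProb m (q y) ≤
      L * (2 * ∑ y : Fin n → Y, wordWeight A s₀ (pairWord y z) * collisionProb m (qo y)) := by
    intro τ hτ
    obtain ⟨y₀, -, hy₀⟩ := Finset.mem_image.1 hτ
    have hsum : τ.sum = n := hy₀ ▸ sum_phraseLengths y₀ z
    have hck : τ.length ≤ k := hy₀ ▸ hk y₀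
    simp only [hA_seg τ hsum, Finset.sum_mul]
    rw [Finset.sum_comm, Finset.sum_comm (s := (Finset.univ : Finset (Fin n → Y))),
      Finset.mul_sum, Finset.mul_sum]
    refine Finset.sum_le_sum fun s _ => ?_
    obtain ⟨hone, hcore⟩ := sum_pathWeight_le hp hB hB1 hA r₀ s₀ z hsum s m rank
    refine le_trans ?_ (mul_le_mul_of_nonneg_left hcore (zero_le_one.trans hL1))
    rw [Finset.mul_sum]
    refine Finset.sum_le_sum fun y hy => ?_
    have hyτ : phraseLengths y z = τ := (Finset.mem_filter.1 hy).2
    rw [mul_left_comm]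
    refine mul_le_mul_of_nonneg_left ?_ (hw0 τ s y)
    have hPy := hP y
    have ha0 : 0 < l ^ τ.length * Real.exp (lzSum y z) * P y := by positivity
    have hle : q y ≤ L * (l ^ τ.length * Real.exp (lzSum y z) * P y) := by
      refine (hqle y).trans ?_
      have h1 : l ^ k ≤ l ^ τ.length := pow_le_pow_of_le_one hl0.le hl1 hck
      have h2 : T * β ^ k ≤ L * l ^ τ.length := by
        rw [hL, div_mul_eq_mul_div, le_div_iff₀ (pow_pos hl0 k)]
        have : 0 ≤ T * β ^ k := by positivity
        gcongr
      calc _ ≤ L * l ^ τ.length * (Real.exp (lzSum y z) * P y) := by gcongr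
        _ = _ := by ring
    exact collisionProb_le_mul m ha0 (hone y hyτ) (hq1 y) hL1 hle
  have hqo01 : ∀ y, 0 ≤ collisionProb m (qo y) := fun y => collisionProb_nonneg m
    (Finset.sum_nonneg fun y' _ => mul_nonneg (hP y').le (by split_ifs <;> norm_num))
    ((Finset.sum_le_sum fun y' _ =>
      mul_le_of_le_one_right (hP y').le (by split_ifs <;> norm_num)).trans_eq hP1)
  have hopt : 0 ≤ ∑ y : Fin n → Y, wordWeight A s₀ (pairWord y z) * collisionProb m (qo y) :=
    Finset.sum_nonneg fun y _ => mul_nonneg (wordWeight_nonneg hA _ _) (hqo01 y)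
  calc ∑ y : Fin n → Y, wordWeight A s₀ (pairWord y z) * collisionProb m (q y)
      = ∑ τ ∈ 𝒯, ∑ y ∈ Finset.univ.filter fun y : Fin n → Y => phraseLengths y z = τ,
          wordWeight A s₀ (pairWord y z) * collisionProb m (q y) :=
        (Finset.sum_fiberwise_of_maps_to
          (fun y _ => Finset.mem_image_of_mem _ (Finset.mem_univ y)) _).symm
    _ ≤ ∑ τ ∈ 𝒯, L * (2 * ∑ y : Fin n → Y,
          wordWeight A s₀ (pairWord y z) * collisionProb m (qo y)) := Finset.sum_le_sum hclass
    -- The second factor T: every class of phrase lengths is compared with the whole error sum of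
    -- the other decoder.
    _ ≤ T * (L * (2 * ∑ y : Fin n → Y,
          wordWeight A s₀ (pairWord y z) * collisionProb m (qo y))) := by
        rw [Finset.sum_const, nsmul_eq_mul]
        have := zero_le_one.trans hL1
        gcongr
    _ = _ := by rw [hL, div_pow]; ring

end Comparison

/-! ### Asymptotics of the redundancy rate. -/

section Asymptotics

open Filter Asymptotics Topology

/-- The phrase length that separates short from long phrases in the count of phrases. -/
noncomputable def cutLength (b n : ℕ) : ℕ := ⌊Real.log n / (2 * Real.log b)⌋₊

/-- A bound for the number of phrases of a word of length `n` over `b` letters. -/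
noncomputable def phraseBound (b n : ℕ) : ℕ :=
  if cutLength b n = 0 then n else 1 + b ^ cutLength b n + n / cutLength b n

/-- The weight parameter used in counting the possible lists of phrase lengths. -/
noncomputable def lengthRate (n : ℕ) : ℝ := 1 / max 2 (Real.log n)

/-- The logarithm of a bound for the number of possible lists of phrase lengths. -/
noncomputable def logLengthCount (k n : ℕ) : ℝ :=
  -(n * Real.log (1 - lengthRate n)) - k * Real.log (lengthRate n)

/-- The exponential rate of the redundancy of universal decoding, when `C` is the loss per
phrase. -/
noncomputable def redundancyRate (b : ℕ) (C : ℝ) (n : ℕ) : ℝ :=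
  (Real.log 2 + 2 * logLengthCount (phraseBound b n) n + phraseBound b n * Real.log C) / n

lemma tendsto_log_natCast : Tendsto (fun n : ℕ => Real.log n) atTop atTop :=
  Real.tendsto_log_atTop.comp tendsto_natCast_atTop_atTop

lemma tendsto_log_log_natCast : Tendsto (fun n : ℕ => Real.log (Real.log n)) atTop atTop :=
  Real.tendsto_log_atTop.comp tendsto_log_natCast

lemma tendsto_cutLength_div_log {b : ℕ} (hb : 2 ≤ b) :
    Tendsto (fun n => (cutLength b n : ℝ) / Real.log n) atTop (𝓝 (1 / (2 * Real.log b))) := by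
  have hlb : 0 < Real.log b := Real.log_pos (by exact_mod_cast hb)
  have h1 : Tendsto (fun n : ℕ => Real.log n / (2 * Real.log b)) atTop atTop :=
    tendsto_log_natCast.atTop_div_const (by positivity)
  have h2 := (tendsto_nat_floor_div_atTop (R := ℝ)).comp h1
  have h3 := h2.mul_const (1 / (2 * Real.log b))
  rw [one_mul] at h3
  refine h3.congr' ?_
  filter_upwards [tendsto_log_natCast.eventually_gt_atTop 0] with n hn
  simp only [Function.comp_apply, cutLength]
  field_simp

lemma tendsto_log_div_natCast : Tendsto (fun n : ℕ => Real.log n / n) atTop (𝓝 0) := by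
  have := (Real.isLittleO_log_id_atTop.tendsto_div_nhds_zero).comp
    (tendsto_natCast_atTop_atTop (R := ℝ))
  exact this

lemma pow_cutLength_le {b n : ℕ} (hb : 2 ≤ b) (hn : 0 < n) :
    ((b : ℝ) ^ cutLength b n) ≤ Real.sqrt n := by
  have hlb : 0 < Real.log b := Real.log_pos (by exact_mod_cast hb)
  have hb0 : (0 : ℝ) < b := by positivity
  have hn0 : (0 : ℝ) < n := by positivity
  have h1 : (cutLength b n : ℝ) ≤ Real.log n / (2 * Real.log b) :=
    Nat.floor_le (div_nonneg (Real.log_natCast_nonneg n) (by positivity))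
  rw [← Real.log_le_log_iff (by positivity) (Real.sqrt_pos.2 hn0), Real.log_pow,
    Real.log_sqrt hn0.le]
  rw [le_div_iff₀ (by positivity)] at h1
  linarith

/-- The cut at log n / (2 log b) keeps the number of short phrases below √n, so n divided by the cut
dominates; this is the origin of the factor 2. -/
lemma tendsto_phraseBound {b : ℕ} (hb : 2 ≤ b) :
    Tendsto (fun n => (phraseBound b n : ℝ) * Real.log n / n) atTop (𝓝 (2 * Real.log b)) := by
  have hlb : 0 < Real.log b := Real.log_pos (by exact_mod_cast hb)
  have hcut := tendsto_cutLength_div_log hb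
  have hinv : Tendsto (fun n : ℕ => Real.log n / (cutLength b n : ℝ)) atTop (𝓝 (2 * Real.log b)) := by
    have := hcut.inv₀ (by positivity)
    simpa using this
  have hcutpos : ∀ᶠ n in atTop, 0 < cutLength b n := by
    filter_upwards [hcut.eventually_const_lt (show 0 < 1 / (2 * Real.log b) by positivity)] with n hn
    by_contra h0
    simp [Nat.eq_zero_of_not_pos h0] at hn
  have hsqrt : Tendsto (fun n : ℕ => Real.sqrt n * Real.log n / n) atTop (𝓝 0) := by
    have h1 := ((isLittleO_log_rpow_atTop (r := 1 / 2) (by norm_num)).tendsto_div_nhds_zero).comp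
      (tendsto_natCast_atTop_atTop (R := ℝ))
    refine h1.congr' ?_
    filter_upwards [eventually_gt_atTop 0] with n hn
    have hn0 : (0 : ℝ) < n := by exact_mod_cast hn
    have hs := Real.sqrt_pos.2 hn0
    simp only [Function.comp_apply, ← Real.sqrt_eq_rpow]
    rw [div_eq_div_iff hs.ne' hn0.ne']
    linear_combination (-Real.log n) * Real.mul_self_sqrt hn0.le
  have hupper : Tendsto (fun n : ℕ => Real.log n / n + Real.sqrt n * Real.log n / n +
      Real.log n / (cutLength b n : ℝ)) atTop (𝓝 (2 * Real.log b)) := by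
    simpa using (tendsto_log_div_natCast.add hsqrt).add hinv
  refine tendsto_of_tendsto_of_tendsto_of_le_of_le' hinv hupper ?_ ?_
  · filter_upwards [hcutpos, eventually_gt_atTop 0] with n hc hn
    have hn0 : (0 : ℝ) < n := by exact_mod_cast hn
    have hc0 : (0 : ℝ) < cutLength b n := by exact_mod_cast hc
    have h1 : (n : ℝ) / cutLength b n ≤ phraseBound b n := by
      rw [phraseBound, if_neg hc.ne', div_le_iff₀ hc0]
      have := Nat.lt_div_mul_add hc (a := n)
      have h2 : n ≤ (1 + b ^ cutLength b n + n / cutLength b n) * cutLength b n := by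
        have h3 := Nat.zero_le (b ^ cutLength b n * cutLength b n)
        rw [add_mul, add_mul, one_mul]
        linarith
      exact_mod_cast h2
    have hlog := Real.log_natCast_nonneg n
    rw [le_div_iff₀ hn0]
    calc _ = (n : ℝ) / cutLength b n * Real.log n := by ring
      _ ≤ _ := by gcongr
  · filter_upwards [hcutpos, eventually_gt_atTop 0] with n hc hn
    have hn0 : (0 : ℝ) < n := by exact_mod_cast hn
    have hc0 : (0 : ℝ) < cutLength b n := by exact_mod_cast hc
    have h1 : (phraseBound b n : ℝ) ≤ 1 + Real.sqrt n + n / cutLength b n := by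
      rw [phraseBound, if_neg hc.ne']
      push_cast
      gcongr
      · exact pow_cutLength_le hb hn
      · exact Nat.cast_div_le
    have hlog := Real.log_natCast_nonneg n
    calc _ ≤ (1 + Real.sqrt n + n / cutLength b n) * Real.log n / n := by gcongr
      _ = _ := by field_simp

/-- With d = 1/log n, the terms -n log(1 - d) and k log C are O(n/log n), so only 2k log log n
survives. The 4 is the 2 of the phrase count times the exponent of T². -/
lemma tendsto_redundancyRate_div {b : ℕ} (hb : 2 ≤ b) (C : ℝ) :
    Tendsto (fun n : ℕ => redundancyRate b C n / (Real.log (Real.log n) / Real.log n)) atTop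
      (𝓝 (4 * Real.log b)) := by
  have hk := tendsto_phraseBound hb
  have hll := tendsto_log_log_natCast.inv_tendsto_atTop
  have h1 : Tendsto (fun n : ℕ => Real.log 2 * (Real.log n / n) * (Real.log (Real.log n))⁻¹) atTop
      (𝓝 0) := by
    simpa using (tendsto_log_div_natCast.const_mul (Real.log 2)).mul hll
  have h2 : Tendsto (fun n : ℕ => -(Real.log n * Real.log (1 - 1 / Real.log n)) *
      (Real.log (Real.log n))⁻¹) atTop (𝓝 0) := by
    have h := (Real.tendsto_mul_log_one_add_div_atTop (-1)).comp tendsto_log_natCast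
    have h' := (h.neg).mul hll
    simp only [neg_neg, mul_zero] at h'
    refine h'.congr fun n => ?_
    simp only [Function.comp_apply, Pi.inv_apply, neg_div, ← sub_eq_add_neg]
  have h3 : Tendsto (fun n : ℕ => (phraseBound b n : ℝ) * Real.log n / n *
      (Real.log C * (Real.log (Real.log n))⁻¹)) atTop (𝓝 0) := by
    simpa using hk.mul (hll.const_mul (Real.log C))
  have hsum := ((h1.add (h2.const_mul 2)).add (hk.const_mul 2)).add h3
  have hlim : (0 : ℝ) + 2 * 0 + 2 * (2 * Real.log b) + 0 = 4 * Real.log b := by ring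
  rw [hlim] at hsum
  refine hsum.congr' ?_
  filter_upwards [eventually_gt_atTop 0, tendsto_log_natCast.eventually_ge_atTop 2,
    tendsto_log_log_natCast.eventually_gt_atTop 0] with n hn hlog hloglog
  have hn0 : (0 : ℝ) < n := by exact_mod_cast hn
  have hrate : lengthRate n = 1 / Real.log n := by rw [lengthRate, max_eq_right hlog]
  have hlr : Real.log (lengthRate n) = -Real.log (Real.log n) := by
    rw [hrate, one_div, Real.log_inv]
  have hlog0 : Real.log n ≠ 0 := by linarith
  rw [redundancyRate, logLengthCount, hlr, hrate]
  generalize Real.log (1 - 1 / Real.log n) = t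
  field_simp
  ring

end Asymptotics
-- Assembly of the bound for the systems.
section Main

lemma length_le_phraseBound {α : Type*} [Fintype α] [DecidableEq α] (hα : 2 ≤ Fintype.card α)
    (w : List α) : (lzParse w).length ≤ phraseBound (Fintype.card α) w.length := by
  have hL := isIncremental_lzParse w
  have hflat := flatten_lzParse w
  unfold phraseBound
  -- For small n the cut is 0 and the bound is n itself: phrases are non-empty.
  split_ifs with h
  · conv_rhs => rw [← hflat, List.length_flatten]
    have := List.card_nsmul_le_sum ((lzParse w).map List.length) 1 (by
      intro l hl
      obtain ⟨p, hp, rfl⟩ := List.mem_map.1 hl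
      exact List.length_pos_iff.2 (hL.ne_nil p hp))
    simpa using this
  · have := length_le_of_isIncremental hα hL (Nat.pos_of_ne_zero h)
    rwa [hflat] at this

lemma lengthRate_pos (n : ℕ) : 0 < lengthRate n := by
  unfold lengthRate; positivity

lemma lengthRate_lt_one (n : ℕ) : lengthRate n < 1 := by
  unfold lengthRate
  rw [div_lt_one (by positivity)]
  exact lt_max_of_lt_left one_lt_two

lemma exp_logLengthCount (k n : ℕ) :
    Real.exp (logLengthCount k n) = ((1 - lengthRate n) ^ n)⁻¹ * (lengthRate n ^ k)⁻¹ := by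
  have h0 := lengthRate_pos n
  have h1 : 0 < 1 - lengthRate n := sub_pos.2 (lengthRate_lt_one n)
  rw [logLengthCount, sub_eq_add_neg, Real.exp_add, Real.exp_neg, Real.exp_neg, Real.exp_nat_mul,
    Real.exp_nat_mul, Real.exp_log h0, Real.exp_log h1]

lemma exp_mul_redundancyRate (b : ℕ) {C : ℝ} (hC : 0 < C) {n : ℕ} (hn : 0 < n) :
    Real.exp (n * redundancyRate b C n) =
      2 * Real.exp (logLengthCount (phraseBound b n) n) ^ 2 * C ^ phraseBound b n := by
  have hn0 : (n : ℝ) ≠ 0 := by exact_mod_cast hn.ne'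
  rw [redundancyRate, mul_div_cancel₀ _ hn0, Real.exp_add, Real.exp_add, Real.exp_log two_pos,
    Real.exp_nat_mul, Real.exp_log hC, ← Real.exp_nat_mul]
  norm_num

variable {X Y Z Ω Θ S : Type*} [Fintype X] [Fintype Y] [Fintype Z]
  [Fintype Ω] [Fintype Θ] [Fintype S]

/-- If there is only one code sequence or no channel output, all rankings have the same error. -/
lemma avgError_eq_of_card_le_one (G : FSSource X Ω) (V : FSChannel X Y Θ) (W : FSChannel X Z S)
    (hYZ : Fintype.card (Y × Z) ≤ 1) {n : ℕ} (hn : 0 < n) (M : ℕ)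
    {d d' : (Fin n → Y) → (Fin n → Z) → ℝ} {rank rank' : (Fin n → Y) → (Fin n → Z) → ℕ}
    (h : IsRanking d rank) (h' : IsRanking d' rank') :
    avgError G V W M rank = avgError G V W M rank' := by
  have heq : rank = rank' := by
    funext y z
    have hcard : Fintype.card Y = 1 := by
      have := Fintype.card_le_one_iff_subsingleton.1 hYZ
      refine Fintype.card_eq_one_iff.2 ⟨y ⟨0, hn⟩, fun a => ?_⟩
      exact congrArg Prod.fst (Subsingleton.elim (a, z ⟨0, hn⟩) (y ⟨0, hn⟩, z ⟨0, hn⟩))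
    have h1 := (h z).1.mapsTo (Set.mem_univ y)
    have h2 := (h' z).1.mapsTo (Set.mem_univ y)
    simp only [hcard, one_pow, Set.mem_Icc] at h1 h2
    omega
  rw [heq]

/-- The loss per phrase of the universal decoder. -/
noncomputable def decodingLoss (y z r s : ℕ) (p : ℝ) : ℝ :=
  y * Real.exp (z + 1) / phraseLoss p r s

/-- The comparison is applied for each z separately and summed; it holds against every competing
ranking, maximum likelihood included. -/
lemma avgError_universal_le [DecidableEq Y] [DecidableEq Z] (hYZ : 2 ≤ Fintype.card (Y × Z))
    {p : ℝ} (hp : 0 < p) (G : FSSource X Ω) (V : FSChannel X Y Θ) (W : FSChannel X Z S)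
    (hπ : ∀ y θ ω θ' ω', p ≤ inducedKernel G V y θ ω θ' ω') {n M : ℕ} (hn : 0 < n) (hM : 0 < M)
    (rank ranku : (Fin n → Y) → (Fin n → Z) → ℕ)
    (hu : IsRanking (fun y z => universalMetric G V y z) ranku) :
    avgError G V W M ranku ≤
      Real.exp (n * redundancyRate (Fintype.card (Y × Z)) (decodingLoss (Fintype.card Y)
        (Fintype.card Z) (Fintype.card (Θ × Ω)) (Fintype.card (Ω × Θ × S)) p) n) *
      avgError G V W M rank := by
  classical
  have hne : Nonempty (Y × Z) := Fintype.card_pos_iff.1 (by omega)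
  have : Nonempty Y := hne.map Prod.fst
  have hB : ∀ y a b, p ≤ codeKernel G V y a b := fun y a b => hπ _ _ _ _ _
  have hB1 := sum_codeKernel G V
  have hB0 : ∀ y a b, 0 ≤ codeKernel G V y a b := fun y a b => hp.le.trans (hB y a b)
  have hA := jointKernel_nonneg G V W
  have hp1 : p ≤ 1 := (hB (Classical.arbitrary Y) (V.init, G.init) (V.init, G.init)).trans
    (kernel_le_one hB0 hB1 _ _ _)
  have hPpos : ∀ y : Fin n → Y, 0 < codeLaw G V y := by
    intro y
    rw [codeLaw_eq_wordWeight, wordWeight_ofFn]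
    exact Finset.sum_pos (fun s _ => Finset.prod_pos fun i _ => hp.trans_le (hB _ _ _))
      ⟨fun _ => (V.init, G.init), Finset.mem_univ _⟩
  have hP1 : ∑ y : Fin n → Y, codeLaw G V y = 1 := by
    simp only [codeLaw_eq_wordWeight]
    exact sum_wordWeight_ofFn hB1 _ n
  have hρ : (0 : ℝ) < Fintype.card (Θ × Ω) := by
    exact_mod_cast Fintype.card_pos_iff.2 ⟨(V.init, G.init)⟩
  have hσ : (0 : ℝ) < Fintype.card (Ω × Θ × S) := by
    exact_mod_cast Fintype.card_pos_iff.2 ⟨(G.init, V.init, W.init)⟩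
  have hY : (0 : ℝ) < Fintype.card Y := by exact_mod_cast Fintype.card_pos
  have hC : 0 < decodingLoss (Fintype.card Y) (Fintype.card Z) (Fintype.card (Θ × Ω))
      (Fintype.card (Ω × Θ × S)) p := by
    unfold decodingLoss phraseLoss; positivity
  have hk : ∀ (z : Fin n → Z) (y : Fin n → Y),
      (phraseLengths y z).length ≤ phraseBound (Fintype.card (Y × Z)) n := by
    intro z y
    have := length_le_phraseBound hYZ (pairWord y z)
    rw [length_pairWord] at this
    rwa [phraseLengths, List.length_map]
  rw [exp_mul_redundancyRate _ hC hn, avgError_eq G V W hM (fun y => (hPpos y).ne') hP1,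
    avgError_eq G V W hM (fun y => (hPpos y).ne') hP1, Finset.mul_sum]
  refine Finset.sum_le_sum fun z _ => ?_
  have hT : ((Finset.univ.image fun y : Fin n → Y => phraseLengths y z).card : ℝ) ≤
      Real.exp (logLengthCount (phraseBound (Fintype.card (Y × Z)) n) n) := by
    rw [exp_logLengthCount]
    refine card_le_of_subset_boundedCompositions _ ?_ (lengthRate_pos n) (lengthRate_lt_one n)
    intro τ hτ
    obtain ⟨y, -, rfl⟩ := Finset.mem_image.1 (Finset.mem_coe.1 hτ)
    refine ⟨sum_phraseLengths y z, hk z y, fun a ha => ?_⟩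
    obtain ⟨w, hw, rfl⟩ := List.mem_map.1 ha
    exact List.length_pos_iff.2 ((isIncremental_lzParse _).ne_nil w hw)
  have := sum_collisionProb_le hp hp1 hB hB1 hA (V.init, G.init) (G.init, V.init, W.init) z (hk z)
    hT (M - 1) (fun y => rank y z) (fun y => ranku y z)
    (fun y => by rw [← codeLaw_eq_wordWeight]; exact hPpos y) (fun y y' hle => by
      rw [← codeLaw_eq_wordWeight, ← codeLaw_eq_wordWeight]
      by_contra hlt
      exact absurd ((hu z).2 y' y (not_le.1 hlt)) (not_lt.2 hle))
  simpa only [decodingLoss, ← codeLaw_eq_wordWeight, pairWord, ← jointLaw_eq_wordWeight] using this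

end Main

lemma isBigO_redundancyRate_and_isLittleO_sub {b : ℕ} (hb : 2 ≤ b) (C : ℝ) :
    Asymptotics.IsBigO Filter.atTop (redundancyRate b C)
        (fun n : ℕ => Real.log (Real.log n) / Real.log n) ∧
      Asymptotics.IsLittleO Filter.atTop
        (fun n : ℕ => redundancyRate b C n -
          4 * Real.log b * (Real.log (Real.log n) / Real.log n))
        (fun n : ℕ => Real.log (Real.log n) / Real.log n) := by
  have hlim := tendsto_redundancyRate_div hb C
  have hne : ∀ᶠ n : ℕ in Filter.atTop, Real.log (Real.log n) / Real.log n ≠ 0 := by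
    filter_upwards [tendsto_log_natCast.eventually_gt_atTop 0,
      tendsto_log_log_natCast.eventually_gt_atTop 0] with n h1 h2
    positivity
  refine ⟨Asymptotics.isBigO_of_div_tendsto_nhds (hne.mono fun n h h0 => absurd h0 h) _ hlim, ?_⟩
  rw [Asymptotics.isLittleO_iff_tendsto' (hne.mono fun n h h0 => absurd h0 h)]
  have := hlim.sub_const (4 * Real.log b)
  rw [sub_self] at this
  refine this.congr' (hne.mono fun n h => ?_)
  simp only [sub_div, mul_div_cancel_right₀ _ h]

end NoisyDecoding

theorem theorem1 :
    ∃ A : ℝ, 0 < A ∧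
      ∀ (Y Z Θ Ω S : Type*) [Fintype Y] [Fintype Z] [Fintype Θ] [Fintype Ω] [Fintype S]
        [DecidableEq Y] [DecidableEq Z] (p : ℝ), 0 < p →
      ∃ ε : ℕ → ℝ,
        Asymptotics.IsBigO Filter.atTop ε
          (fun n : ℕ => Real.log (Real.log n) / Real.log n) ∧
        Asymptotics.IsLittleO Filter.atTop
          (fun n : ℕ => ε n -
            A * Real.log (Fintype.card (Y × Z)) * (Real.log (Real.log n) / Real.log n))
          (fun n : ℕ => Real.log (Real.log n) / Real.log n) ∧
        ∀ (X : Type*) [Fintype X] (G : NoisyDecoding.FSSource X Ω)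
          (V : NoisyDecoding.FSChannel X Y Θ) (W : NoisyDecoding.FSChannel X Z S),
          (∀ (y : Y) (θ : Θ) (ω : Ω) (θ' : Θ) (ω' : Ω),
            p ≤ NoisyDecoding.inducedKernel G V y θ ω θ' ω') →
          ∀ (n M : ℕ), 0 < n → 0 < M →
          ∀ (Mo Mu : (Fin n → Y) → (Fin n → Z) → ℕ),
            NoisyDecoding.IsRanking
              (fun y z => -NoisyDecoding.inducedChannel G V W z y) Mo →
            NoisyDecoding.IsRanking
              (fun y z => NoisyDecoding.universalMetric G V y z) Mu →
            NoisyDecoding.avgError G V W M Mu ≤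
              Real.exp (n * ε n) * NoisyDecoding.avgError G V W M Mo := by
  refine ⟨4, by norm_num, ?_⟩
  intro Y Z Θ Ω S _ _ _ _ _ _ _ p hp
  rcases Nat.lt_or_ge 1 (Fintype.card (Y × Z)) with hb | hb
  · obtain ⟨hO, ho⟩ := NoisyDecoding.isBigO_redundancyRate_and_isLittleO_sub hb
      (NoisyDecoding.decodingLoss (Fintype.card Y) (Fintype.card Z) (Fintype.card (Θ × Ω))
        (Fintype.card (Ω × Θ × S)) p)
    exact ⟨_, hO, ho, fun X _ G V W hπ n M hn hM Mo Mu _ hMu =>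
      NoisyDecoding.avgError_universal_le hb hp G V W hπ hn hM Mo Mu hMu⟩
  -- With at most one pair of letters the leading term vanishes, also for an empty alphabet since
  -- `Real.log 0 = 0`; the rankings agree and zero redundancy works.
  · have hlog : Real.log (Fintype.card (Y × Z)) = 0 := by
      interval_cases Fintype.card (Y × Z) <;> simp
    refine ⟨fun _ => 0, Asymptotics.isBigO_zero _ _, ?_, ?_⟩
    · simp only [hlog, mul_zero, zero_mul, sub_zero]
      exact Asymptotics.isLittleO_zero _ _
    · intro X _ G V W _ n M hn _ Mo Mu hMo hMu
      rw [mul_zero, Real.exp_zero, one_mul,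
        NoisyDecoding.avgError_eq_of_card_le_one G V W hb hn M hMu hMo]
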